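/- Let $G$ be a discrete group, $R$ a commutative ring, $\mathfrak F$ the family of finite subgroups of $G$, and $\Delta=\coprod_{H\in\mathfrak F}G/H$. An $RG$-module is *$\mathfrak F$-projective* if it is a direct summand of $N\otimes_R R\Delta$ (diagonal action) for some $RG$-module $N$. An acyclic complex of $RG$-modules is *$\mathfrak F$-split* if its restriction to every finite subgroup $H\le G$ is split exact over $RH$; a resolution $P_*\to M$ is $\mathfrak F$-split if the augmented complex $\cdots\to P_1\to P_0\to M\to 0$ is. An *$\mathfrak F$-complete resolution* of $M$ is an acyclic $\mathfrak F$-split complex $T_*=(T_i)_{i\in\mathbb Z}$ of $\mathfrak F$-projectives which coincides in all sufficiently high degrees with an $\mathfrak F$-split resolution of $M$ by $\mathfrak F$-projectives; it is *$\mathfrak F$-strong* if $\operatorname{Hom}_{RG}(T_*,Q)$ is exact for every $\mathfrak F$-projective $Q$. A module is *$\mathfrak F_G$-projective* if it is a cokernel (of some differential) in an $\mathfrak F$-strong $\mathfrak F$-complete resolution, and a complex $C_*$ is *$\mathfrak F_G$-proper* if $\operatorname{Hom}_{RG}(Q,C_*)$ is exact for every $\mathfrak F_G$-projective $Q$; a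 resolution is $\mathfrak F_G$-proper if its augmented complex is. Put $$\mathfrak F H^n(G,-)=H^n\operatorname{Hom}_{RG}(P_*,-),\qquad \widehat{\mathfrak F H}{}^n(G,-)=H^n\operatorname{Hom}_{RG}(T_*,-),\qquad \mathfrak F_G H^n(G,-)=H^n\operatorname{Hom}_{RG}(L_*,-),$$ where $P_*$ is an $\mathfrak F$-split resolution of the trivial module $R$ by $\mathfrak F$-projectives, $T_*$ is an $\mathfrak F$-strong $\mathfrak F$-complete resolution of $R$, and $L_*$ is an $\mathfrak F_G$-proper resolution of $R$ by $\mathfrak F_G$-projectives. **Theorem.** Suppose that $R$ admits an $\mathfrak F$-strong $\mathfrak F$-complete resolution $T_*$. Then $R$ admits an $\mathfrak F_G$-proper resolution by $\mathfrak F_G$-projectives, so that $\mathfrak F_G H^*(G,-)$ is defined, and for every choice of $P_*$ and $L_*$ as above there is a long exact sequence of functors on $RG$-modules (with natural maps) $$0\to\mathfrak F_G H^1(G,-)\to\mathfrak F H^1(G,-)\to\widehat{\mathfrak F H}{}^1(G,-)\to\mathfrak F_G H^2(G,-)\to\cdots$$ $$\cdots\to\mathfrak F_G H^n(G,-)\to\mathfrak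 F H^n(G,-)\to\widehat{\mathfrak F H}{}^n(G,-)\to\mathfrak F_G H^{n+1}(G,-)\to\cdots$$ in which the maps $\mathfrak F_G H^n\to\mathfrak F H^n$ are induced by a chain map $P_*\to L_*$ lifting $\mathrm{id}_R$, and the maps $\mathfrak F H^n\to\widehat{\mathfrak F H}{}^n$ are induced by a chain map $T_*\to P_*$ which, in the high degrees where $T_*$ coincides with an $\mathfrak F$-split $\mathfrak F$-projective resolution of $R$, is given by a chain map of resolutions lifting $\mathrm{id}_R$. -/

import Mathlib

open CategoryTheory CategoryTheory.Limits MonoidalCategory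

universe u

noncomputable section

namespace FamilyCohomology

variable {R G : Type u} [CommRing R] [Group G]

/-! ### Cohomology of `Hom_{RG}(C, -)` -/

section Hom

variable {ι : Type*} {c : ComplexShape ι}

/-- The functor `M ↦ Hom_{RG}(C, M)`, with values in complexes of `R`-modules: in degree `i` it is
`Hom_{RG}(C_i, M)`, and the differentials are given by precomposition with those of `C`. -/
def homComplex (C : HomologicalComplex (Rep.{u} R G) c) :
    Rep.{u} R G ⥤ HomologicalComplex (ModuleCat.{u} R) c.symm where
  obj M := (((linearYoneda R (Rep.{u} R G)).obj M).mapHomologicalComplex c.symm).obj C.op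
  map f := (NatTrans.mapHomologicalComplex
    ((linearYoneda R (Rep.{u} R G)).map f) c.symm).app C.op

/-- Precomposition with a chain map `f : C ⟶ D`, as a natural transformation
`Hom_{RG}(D, -) ⟶ Hom_{RG}(C, -)`. -/
def homComplexMap {C D : HomologicalComplex (Rep.{u} R G) c} (f : C ⟶ D) :
    homComplex D ⟶ homComplex C where
  app M := (((linearYoneda R (Rep.{u} R G)).obj M).mapHomologicalComplex c.symm).map
    ((HomologicalComplex.opFunctor (Rep.{u} R G) c).map f.op)
  naturality _ _ g := (NatTrans.mapHomologicalComplex_naturality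
    ((linearYoneda R (Rep.{u} R G)).map g)
    ((HomologicalComplex.opFunctor (Rep.{u} R G) c).map f.op)).symm

/-- The functor `M ↦ H^i Hom_{RG}(C, M)`. -/
def cohomology (C : HomologicalComplex (Rep.{u} R G) c) (i : ι) :
    Rep.{u} R G ⥤ ModuleCat.{u} R :=
  homComplex C ⋙ HomologicalComplex.homologyFunctor (ModuleCat.{u} R) c.symm i

/-- The natural transformation `H^i Hom_{RG}(D, -) ⟶ H^i Hom_{RG}(C, -)` induced by a chain map
`C ⟶ D`. -/
def cohomologyMap {C D : HomologicalComplex (Rep.{u} R G) c} (f : C ⟶ D) (i : ι) :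
    cohomology D i ⟶ cohomology C i :=
  Functor.whiskerRight (homComplexMap f)
    (HomologicalComplex.homologyFunctor (ModuleCat.{u} R) c.symm i)

end Hom

/-! ### `𝔉`-projectives and `𝔉`-split complexes -/

variable (G) in
/-- The `G`-set `Δ = ∐ G/H`, where `H` runs over the finite subgroups of `G`. -/
abbrev Delta : Type u := Σ H : {H : Subgroup G // Finite H}, G ⧸ H.1

/-- An `RG`-module is `𝔉`-projective if it is a direct summand of `N ⊗_R RΔ` (with the diagonal
action) for some `RG`-module `N`. -/
def IsFProjective (Q : Rep.{u} R G) : Prop :=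
  ∃ N : Rep.{u} R G, Nonempty (Retract Q (N ⊗ Rep.ofMulAction R G (Delta G)))

/-- A complex of `RG`-modules is acyclic and `𝔉`-split if it is exact and if its restriction to
every finite subgroup `H` of `G` is a split exact complex of `RH`-modules, that is, the identity
of the restriction is null-homotopic over `RH`. -/
def IsFSplit {ι : Type*} {c : ComplexShape ι} (C : HomologicalComplex (Rep.{u} R G) c) : Prop :=
  C.Acyclic ∧ ∀ H : Subgroup G, Finite H →
    Nonempty (Homotopy
      (𝟙 (((Rep.resFunctor (k := R) H.subtype).mapHomologicalComplex c).obj C)) 0)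

/-! ### Resolutions -/

/-- A chain complex `⋯ ⟶ C_1 ⟶ C_0` together with an augmentation `C_0 ⟶ M`. -/
structure AugmentedComplex (M : Rep.{u} R G) where
  cx : ChainComplex (Rep.{u} R G) ℕ
  ε : cx.X 0 ⟶ M
  d_comp_ε : cx.d 1 0 ≫ ε = 0

namespace AugmentedComplex

variable {M : Rep.{u} R G}

/-- The complex `⋯ ⟶ C_1 ⟶ C_0 ⟶ M ⟶ 0`. -/
def augmented (C : AugmentedComplex M) : ChainComplex (Rep.{u} R G) ℕ :=
  C.cx.augment C.ε C.d_comp_ε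

/-- A chain map between augmented complexes over `M` lifts the identity of `M`. -/
def LiftsId (C D : AugmentedComplex M) (f : C.cx ⟶ D.cx) : Prop :=
  f.f 0 ≫ D.ε = C.ε

end AugmentedComplex

/-- The inclusion of `ℕ` in `ℤ`, for chain complexes. -/
def natToInt : (ComplexShape.down ℕ).Embedding (ComplexShape.down ℤ) :=
  ComplexShape.Embedding.mk' _ _ (fun n => (n : ℤ)) Nat.cast_injective
    (fun i j => by simp only [ComplexShape.down_Rel]; omega)

/-- A chain complex `⋯ ⟶ C_1 ⟶ C_0` regarded as a `ℤ`-graded one, with `0` in the negative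
degrees. -/
abbrev toInt (C : ChainComplex (Rep.{u} R G) ℕ) : ChainComplex (Rep.{u} R G) ℤ :=
  C.extend natToInt

/-- The component of `toInt C` in a degree `i ≥ 0` is `C_i`. -/
def toIntXIso (C : ChainComplex (Rep.{u} R G) ℕ) (i : ℕ) : (toInt C).X (i : ℤ) ≅ C.X i :=
  C.extendXIso natToInt rfl

/-- A chain map of `ℕ`-graded complexes, extended by `0`. -/
abbrev toIntMap {C D : ChainComplex (Rep.{u} R G) ℕ} (f : C ⟶ D) : toInt C ⟶ toInt D :=
  HomologicalComplex.extendMap f natToInt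

/-- An `𝔉`-split resolution of `M` by `𝔉`-projectives. -/
structure FResolution (M : Rep.{u} R G) extends AugmentedComplex M where
  projective : ∀ i, IsFProjective (cx.X i)
  split : IsFSplit toAugmentedComplex.augmented

/-- An `𝔉`-complete resolution of `M`: an acyclic `𝔉`-split complex `cx` of `𝔉`-projectives which
coincides with an `𝔉`-split `𝔉`-projective resolution `res` of `M` in degrees `≥ index`. -/
structure FCompleteResolution (M : Rep.{u} R G) where
  cx : ChainComplex (Rep.{u} R G) ℤ
  projective : ∀ i, IsFProjective (cx.X i)
  split : IsFSplit cx
  res : FResolution M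
  index : ℕ
  iso : ∀ i : ℕ, index ≤ i → (cx.X (i : ℤ) ≅ res.cx.X i)
  comm : ∀ (i : ℕ) (hi : index ≤ i),
    cx.d ((i + 1 : ℕ) : ℤ) (i : ℤ) ≫ (iso i hi).hom =
      (iso (i + 1) (Nat.le_succ_of_le hi)).hom ≫ res.cx.d (i + 1) i

/-- An `𝔉`-complete resolution `T` is `𝔉`-strong if `Hom_{RG}(T, Q)` is exact for every
`𝔉`-projective `Q`. -/
def FCompleteResolution.IsFStrong {M : Rep.{u} R G} (T : FCompleteResolution M) : Prop :=
  ∀ Q : Rep.{u} R G, IsFProjective Q → ((homComplex T.cx).obj Q).Acyclic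

/-- An `RG`-module is `𝔉_G`-projective if it is a cokernel in an `𝔉`-strong `𝔉`-complete
resolution (of some module). -/
def IsFGProjective (Q : Rep.{u} R G) : Prop :=
  ∃ (M : Rep.{u} R G) (T : FCompleteResolution M) (i : ℤ),
    T.IsFStrong ∧ Nonempty (Q ≅ cokernel (T.cx.d (i + 1) i))

/-- A complex `C` of `RG`-modules is `𝔉_G`-proper if `Hom_{RG}(Q, C)` is exact for every
`𝔉_G`-projective `Q`. -/
def IsFGProper {ι : Type*} {c : ComplexShape ι} (C : HomologicalComplex (Rep.{u} R G) c) : Prop :=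
  ∀ Q : Rep.{u} R G, IsFGProjective Q →
    ((((linearCoyoneda R (Rep.{u} R G)).obj (Opposite.op Q)).mapHomologicalComplex c).obj
      C).Acyclic

/-- An `𝔉_G`-proper resolution of `M` by `𝔉_G`-projectives. -/
structure FGResolution (M : Rep.{u} R G) extends AugmentedComplex M where
  projective : ∀ i, IsFGProjective (cx.X i)
  exact : toAugmentedComplex.augmented.Acyclic
  proper : IsFGProper toAugmentedComplex.augmented

/-! ### The three cohomology theories

Each is computed by a resolution of the trivial module `R`. -/

variable (R G) in
/-- The `RG`-module `R` with trivial action. -/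
abbrev triv : Rep.{u} R G := Rep.trivial R G R

/-- `𝔉H^n(G, -)`, computed by an `𝔉`-split `𝔉`-projective resolution of `R`. -/
abbrev FH (P : FResolution (triv R G)) (n : ℕ) : Rep.{u} R G ⥤ ModuleCat.{u} R :=
  cohomology (toInt P.cx) (n : ℤ)

/-- Complete `𝔉`-cohomology in degree `n`, computed by an `𝔉`-strong `𝔉`-complete resolution
of `R`. -/
abbrev FHhat (T : FCompleteResolution (triv R G)) (n : ℕ) : Rep.{u} R G ⥤ ModuleCat.{u} R :=
  cohomology T.cx (n : ℤ)

/-- `𝔉_G H^n(G, -)`, computed by an `𝔉_G`-proper `𝔉_G`-projective resolution of `R`. -/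
abbrev FGH (L : FGResolution (triv R G)) (n : ℕ) : Rep.{u} R G ⥤ ModuleCat.{u} R :=
  cohomology (toInt L.cx) (n : ℤ)

/-- A chain map `θ : T ⟶ P` from an `𝔉`-complete resolution of `M` to an `𝔉`-split `𝔉`-projective
resolution of `M` is a comparison map if, in all degrees in which `T` coincides with its
resolution `T.res`, it is given by a chain map `T.res ⟶ P` lifting the identity of `M`. -/
def IsComparison {M : Rep.{u} R G} (T : FCompleteResolution M) (P : FResolution M)
    (θ : T.cx ⟶ toInt P.cx) : Prop :=
  ∃ f : T.res.cx ⟶ P.cx,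
    AugmentedComplex.LiftsId T.res.toAugmentedComplex P.toAugmentedComplex f ∧
    ∀ (i : ℕ) (hi : T.index ≤ i),
      θ.f (i : ℤ) ≫ (toIntXIso P.cx i).hom = (T.iso i hi).hom ≫ f.f i

/-- Natural maps `ε n : 𝔉_G H^n ⟶ 𝔉H^n`, `η n` from `𝔉H^n` to complete `𝔉`-cohomology, and `δ n`
from complete `𝔉`-cohomology to `𝔉_G H^(n+1)` form, for `n ≥ 1`, a long exact sequence of functors
starting with `0 ⟶ 𝔉_G H^1 ⟶ 𝔉H^1`. -/
def IsLongExact {P : FResolution (triv R G)} {T : FCompleteResolution (triv R G)}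
    {L : FGResolution (triv R G)} (ε : ∀ n : ℕ, FGH L n ⟶ FH P n)
    (η : ∀ n : ℕ, FH P n ⟶ FHhat T n) (δ : ∀ n : ℕ, FHhat T n ⟶ FGH L (n + 1)) : Prop :=
  ∀ M : Rep.{u} R G,
    Function.Injective ((ε 1).app M) ∧
    ∀ n : ℕ, 1 ≤ n →
      Function.Exact ((ε n).app M) ((η n).app M) ∧
      Function.Exact ((η n).app M) ((δ n).app M) ∧
      Function.Exact ((δ n).app M) ((ε (n + 1)).app M)

end FamilyCohomology

end

/-! Let `T` be the given complete resolution, and let `T.res` be the resolution with which it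
coincides in high degrees. Since `Hom(T, Q)` is exact for `𝔉`-projective `Q`, the identification in
high degrees extends downwards, one degree at a time, to a chain map θ from the part of `T` in
degrees `≥ 0` to `T.res` (`exists_extension`). Everything rests on the cone of θ, with `T.res_0 ⊞
coker (T_1 ⟶ T_0)` in degree `0` and `T.res_{n+1} ⊞ T_n` in degree `n + 1`. It contains `T.res`,
with quotient `⋯ ⟶ T_1 ⟶ T_0 ⟶ coker ⟶ 0`, which is exact because `T` is. So the cone is again a
resolution, even after applying `Hom(Q, -)` with `Q` an `𝔉`-projective (`AntiMap.homExact_cone`).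

The terms of the cone are `𝔉_G`-projective, because an `𝔉`-projective summand can be absorbed by
adding a contractible complex to `T`. For properness, let `S` be any strong complete resolution.
Where θ is an isomorphism, the cycles of the cone are copies of the `𝔉`-projectives `T.res_{n+2}`,
so `Hom(S, -)` into them is exact (`AntiMap.cyclesExact`). Dimension shifting carries this down to
the cycles in all degrees (`CyclesExact.of_succ`), and then the cokernels of `S` lift cycles
(`homExact_cokernel_of_cyclesExact`).

The degreewise split sequence `T.res ⟶ cone ⟶ quotient` gives the long exact sequence. Applying
`Hom(-, M)` to the quotient yields the cohomology of `Hom(T, M)` at `T_n` for `n ≥ 1`, and zero at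
`T_0`, since `Hom(coker, M)` is the kernel of `Hom(T_0, M) ⟶ Hom(T_1, M)`. That is why the sequence
begins with an injection in degree `1`.

Arbitrary `P` and `L` are compared with `T.res` and the cone by the relative comparison theorem. For
`P` this needs `𝔉`-projectives to lift cycles of `𝔉`-split complexes (`IsFContractible.homExact`),
where contractions over the finite subgroups are conjugated along the cosets in `Δ`. -/

noncomputable section

namespace FamilyCohomology

variable {R G : Type u} [CommRing R] [Group G]

/-! ### Relative projectivity -/

section Lifting

variable {X Y : Rep.{u} R G}

/-- A family of maps `X ⟶ Y`, equivariant over the finite subgroups `H`, spread over the cosets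
of these subgroups by conjugation. -/
def cosetMap
    (e : ∀ H : {H : Subgroup G // Finite H}, Rep.res H.1.subtype X ⟶ Rep.res H.1.subtype Y)
    (x : Delta G) : X.V →ₗ[R] Y.V :=
  Y.ρ x.2.out ∘ₗ (e x.1).hom.toLinearMap ∘ₗ X.ρ x.2.out⁻¹

variable (e : ∀ H : {H : Subgroup G // Finite H}, Rep.res H.1.subtype X ⟶ Rep.res H.1.subtype Y)

/-- The chosen representative is `x * h` with `h ∈ H`, and the factor `h` cancels because `e H`
commutes with `H`. -/
lemma cosetMap_mk (H : {H : Subgroup G // Finite H}) (x : G) (v : X.V) :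
    cosetMap e ⟨H, (x : G ⧸ H.1)⟩ v = Y.ρ x ((e H).hom (X.ρ x⁻¹ v)) := by
  obtain ⟨h, hh⟩ := QuotientGroup.mk_out_eq_mul H.1 x
  have key := Rep.hom_comm_apply (e H) h⁻¹ (X.ρ x⁻¹ v)
  have hX : (Rep.res H.1.subtype X).ρ h⁻¹ (X.ρ x⁻¹ v) = X.ρ ((x * h)⁻¹) v := by
    rw [Rep.res_obj_ρ, mul_inv_rev, map_mul]
    rfl
  have hY : ∀ w : Y.V, Y.ρ (x * h) ((Rep.res H.1.subtype Y).ρ h⁻¹ w) = Y.ρ x w := by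
    intro w
    have : (Rep.res H.1.subtype Y).ρ h⁻¹ w = Y.ρ (h : G)⁻¹ w := rfl
    rw [this, ← Module.End.mul_apply, ← map_mul, mul_inv_cancel_right]
  change Y.ρ (Quotient.out (x : G ⧸ H.1)) ((e H).hom (X.ρ (Quotient.out (x : G ⧸ H.1))⁻¹ v)) = _
  rw [hh, ← hX, key, hY]

lemma cosetMap_smul (g : G) (x : Delta G) (v : X.V) :
    cosetMap e (g • x) (X.ρ g v) = Y.ρ g (cosetMap e x v) := by
  obtain ⟨H, q⟩ := x
  obtain ⟨x, rfl⟩ := QuotientGroup.mk_surjective q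
  have : g • (⟨H, (x : G ⧸ H.1)⟩ : Delta G) = ⟨H, ((g * x : G) : G ⧸ H.1)⟩ := rfl
  rw [this, cosetMap_mk, cosetMap_mk, ← Module.End.mul_apply (X.ρ _), ← map_mul,
    ← Module.End.mul_apply (Y.ρ g), ← map_mul]
  simp

variable {N : Rep.{u} R G}

/-- The map `N ⊗ RΔ ⟶ Y` given on the summand `N ⊗ x` by the composite of `f` with the map attached
to the coset `x`. -/
def tensorDeltaLift (f : N ⊗ Rep.ofMulAction R G (Delta G) ⟶ X) :
    N ⊗ Rep.ofMulAction R G (Delta G) ⟶ Y :=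
  Rep.ofHom ⟨TensorProduct.lift (LinearMap.flip
    (Finsupp.lift (N.V →ₗ[R] Y.V) R (Delta G) (fun x => cosetMap e x ∘ₗ f.hom.toLinearMap ∘ₗ
      (TensorProduct.mk R N.V (MonoidAlgebra R (Delta G))).flip (MonoidAlgebra.single x 1)) ∘ₗ
      (MonoidAlgebra.coeffLinearEquiv R).toLinearMap)), fun g => by
    ext n x
    have : f.hom (N.ρ g n ⊗ₜ[R] MonoidAlgebra.single (g • x) 1) =
        X.ρ g (f.hom (n ⊗ₜ[R] MonoidAlgebra.single x 1)) := by
      rw [← Rep.hom_comm_apply f g]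
      exact congrArg _ (by simp)
    simp [this, cosetMap_smul]⟩

lemma tensorDeltaLift_apply (f : N ⊗ Rep.ofMulAction R G (Delta G) ⟶ X) (n : N.V) (x : Delta G) :
    (tensorDeltaLift e f).hom (n ⊗ₜ[R] MonoidAlgebra.single x 1) =
      cosetMap e x (f.hom (n ⊗ₜ[R] MonoidAlgebra.single x 1)) := by
  simp [tensorDeltaLift]

lemma tensorDelta_hom_ext {f g : N ⊗ Rep.ofMulAction R G (Delta G) ⟶ X}
    (h : ∀ (n : N.V) (x : Delta G), f.hom (n ⊗ₜ[R] MonoidAlgebra.single x 1) =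
      g.hom (n ⊗ₜ[R] MonoidAlgebra.single x 1)) : f = g := by
  have key : ∀ F F' : TensorProduct R N.V (MonoidAlgebra R (Delta G)) →ₗ[R] X.V,
      (∀ (n : N.V) (x : Delta G), F (n ⊗ₜ[R] MonoidAlgebra.single x 1) =
        F' (n ⊗ₜ[R] MonoidAlgebra.single x 1)) → F = F' := by
    intro F F' h
    ext n x
    exact h n x
  exact Rep.hom_ext (Representation.IntertwiningMap.ext (key _ _ h))

end Lifting

/-! ### Lifting cycles of complexes through `𝔉`-projectives -/

section HomExact

variable {ι : Type*} {c : ComplexShape ι}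

/-- Every cycle `Q ⟶ C_j` of `Hom_{RG}(Q, C)` is a boundary. -/
def HomExact (Q : Rep.{u} R G) (C : HomologicalComplex (Rep.{u} R G) c) : Prop :=
  ∀ ⦃i j : ι⦄, c.Rel i j → ∀ f : Q ⟶ C.X j, (∀ k, c.Rel j k → f ≫ C.d j k = 0) →
    ∃ g : Q ⟶ C.X i, g ≫ C.d i j = f

/-- The restriction of `C` to every finite subgroup is contractible. -/
def IsFContractible (C : HomologicalComplex (Rep.{u} R G) c) : Prop :=
  ∀ H : Subgroup G, Finite H → Nonempty (Homotopy
    (𝟙 (((Rep.resFunctor (k := R) H.subtype).mapHomologicalComplex c).obj C)) 0)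

variable {C : HomologicalComplex (Rep.{u} R G) c}

/-- In the contraction identity `dh + hd = 1`, the term `hd` vanishes on a cycle, so `h` supplies a
preimage. It is phrased for elements because it is applied coset by coset. -/
lemma apply_homotopy_of_cycle {H : Subgroup G}
    (h : Homotopy (𝟙 (((Rep.resFunctor (k := R) H.subtype).mapHomologicalComplex c).obj C)) 0)
    {i j : ι} (hij : c.Rel i j) (v : (C.X j).V) (hv : ∀ k, c.Rel j k → (C.d j k).hom v = 0) :
    (C.d i j).hom ((h.hom j i).hom v) = v := by
  have hc := h.comm j
  rw [prevD_eq _ hij] at hc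
  have h0 : (dNext j h.hom).hom v = 0 := by
    by_cases hjk : c.Rel j (c.next j)
    · rw [dNext_eq _ hjk, Rep.hom_comp]
      change (h.hom (c.next j) j).hom ((C.d j (c.next j)).hom v) = 0
      exact (congrArg _ (hv _ hjk)).trans (map_zero _)
    · rw [dNext_eq_zero _ _ hjk]
      rfl
  have := congrArg (fun φ => φ.hom v) hc
  simp only [HomologicalComplex.zero_f, add_zero, Rep.add_hom] at this
  let w : (C.X j).V := (dNext j h.hom).hom v
  have e : v = w + (C.d i j).hom ((h.hom j i).hom v) := this
  rw [show w = 0 from h0, zero_add] at e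
  exact e.symm

lemma HomExact.of_retract {Q Q' : Rep.{u} R G} (r : Retract Q Q') (h : HomExact Q' C) :
    HomExact Q C := by
  intro i j hij f hf
  obtain ⟨g, hg⟩ := h hij (r.r ≫ f) (fun k hk => by rw [Category.assoc, hf k hk, comp_zero])
  exact ⟨r.i ≫ g, by rw [Category.assoc, hg, r.retract_assoc]⟩

/-- Relative projectivity of `𝔉`-projectives: they lift cycles of `𝔉`-split complexes. -/
theorem IsFContractible.homExact (hC : IsFContractible C) {Q : Rep.{u} R G}
    (hQ : IsFProjective Q) : HomExact Q C := by
  obtain ⟨N, ⟨r⟩⟩ := hQ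
  refine HomExact.of_retract r ?_
  intro i j hij f hf
  let h : ∀ H : {H : Subgroup G // Finite H}, Homotopy
    (𝟙 (((Rep.resFunctor (k := R) H.1.subtype).mapHomologicalComplex c).obj C)) 0 :=
    fun H => (hC H.1 H.2).some
  let e : ∀ H : {H : Subgroup G // Finite H},
    Rep.res H.1.subtype (C.X j) ⟶ Rep.res H.1.subtype (C.X i) := fun H => (h H).hom j i
  -- On `n ⊗ xH` the lift is `x h x⁻¹` applied to the value of `f`, with `h` the contraction over
  -- `H`. Translating by `x⁻¹` keeps that value a cycle, so `d` undoes `h` there.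
  refine ⟨tensorDeltaLift e f, ?_⟩
  refine tensorDelta_hom_ext fun n x => ?_
  obtain ⟨H, q⟩ := x
  obtain ⟨x, rfl⟩ := QuotientGroup.mk_surjective q
  change (C.d i j).hom ((tensorDeltaLift e f).hom (n ⊗ₜ[R] MonoidAlgebra.single _ 1)) =
    f.hom (n ⊗ₜ[R] MonoidAlgebra.single _ 1)
  rw [tensorDeltaLift_apply, cosetMap_mk, Rep.hom_comm_apply]
  have key := apply_homotopy_of_cycle (h H) hij
    ((C.X j).ρ x⁻¹ (f.hom (n ⊗ₜ[R] MonoidAlgebra.single ⟨H, (x : G ⧸ H.1)⟩ 1))) (fun k hk => by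
      rw [Rep.hom_comm_apply]
      have := congrArg (fun φ => φ.hom (n ⊗ₜ[R] MonoidAlgebra.single ⟨H, (x : G ⧸ H.1)⟩ 1))
        (hf k hk)
      have h' : (C.d j k).hom (f.hom (n ⊗ₜ[R] MonoidAlgebra.single ⟨H, (x : G ⧸ H.1)⟩ 1)) = 0 :=
        this
      rw [h', map_zero])
  refine (congrArg ((C.X j).ρ x) key).trans ?_
  rw [← Module.End.mul_apply, ← map_mul]
  simp

/-- The augmentation `N ⊗ RΔ ⟶ N`. -/
def tensorDeltaCounit (N : Rep.{u} R G) : N ⊗ Rep.ofMulAction R G (Delta G) ⟶ N :=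
  Rep.ofHom ⟨TensorProduct.lift (LinearMap.flip
    (Finsupp.lift (N.V →ₗ[R] N.V) R (Delta G) (fun _ => LinearMap.id) ∘ₗ
      (MonoidAlgebra.coeffLinearEquiv R).toLinearMap)), fun g => by ext n x; simp⟩

instance epi_tensorDeltaCounit (N : Rep.{u} R G) : Epi (tensorDeltaCounit N) := by
  rw [Rep.epi_iff_surjective]
  intro n
  -- The trivial subgroup is finite, so `Δ` has a point and the augmentation is surjective.
  refine ⟨n ⊗ₜ[R] MonoidAlgebra.single ⟨⟨⊥, inferInstance⟩, ((1 : G) : G ⧸ (⊥ : Subgroup G))⟩ 1, ?_⟩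
  simp [tensorDeltaCounit]

lemma isFProjective_tensorDelta (N : Rep.{u} R G) :
    IsFProjective (N ⊗ Rep.ofMulAction R G (Delta G)) :=
  ⟨N, ⟨Retract.refl _⟩⟩

/-- A complex is acyclic if `𝔉`-projectives lift its cycles. -/
lemma acyclic_of_homExact (hc : ∀ j, ∃ i, c.Rel i j)
    (hC : ∀ Q : Rep.{u} R G, IsFProjective Q → HomExact Q C) : C.Acyclic := by
  intro j
  obtain ⟨i, hij⟩ := hc j
  rw [HomologicalComplex.exactAt_iff' C i j (c.next j) (c.prev_eq' hij) rfl,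
    ShortComplex.exact_iff_exact_up_to_refinements]
  intro A x hx
  -- An arbitrary test object `A` is covered by the `𝔉`-projective `A ⊗ RΔ`, over which the cycle
  -- lifts. Exactness only asks for a lift up to such a cover.
  obtain ⟨g, hg⟩ := hC _ (isFProjective_tensorDelta A) hij (tensorDeltaCounit A ≫ x) (by
    intro k hk
    obtain rfl := c.next_eq' hk
    exact (Category.assoc _ _ _).trans ((congrArg _ hx).trans comp_zero))
  exact ⟨_, tensorDeltaCounit A, inferInstance, g, hg.symm⟩

lemma IsFContractible.isFSplit (hc : ∀ j, ∃ i, c.Rel i j) (hC : IsFContractible C) :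
    IsFSplit C :=
  ⟨acyclic_of_homExact hc (fun _ hQ => hC.homExact hQ), hC⟩

lemma IsFSplit.homExact (hC : IsFSplit C) {Q : Rep.{u} R G} (hQ : IsFProjective Q) :
    HomExact Q C :=
  IsFContractible.homExact hC.2 hQ

end HomExact

/-! ### Closure properties of `𝔉`-projectives -/

lemma IsFProjective.of_retract {Q Q' : Rep.{u} R G} (r : Retract Q Q') (h : IsFProjective Q') :
    IsFProjective Q := by
  obtain ⟨N, ⟨s⟩⟩ := h
  exact ⟨N, ⟨r.trans s⟩⟩

lemma IsFProjective.biprod {P Q : Rep.{u} R G} (hP : IsFProjective P) (hQ : IsFProjective Q) :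
    IsFProjective (P ⊞ Q) := by
  obtain ⟨N, ⟨r⟩⟩ := hP
  obtain ⟨N', ⟨s⟩⟩ := hQ
  refine ⟨N ⊞ N', ⟨⟨biprod.desc (r.i ≫ biprod.inl ▷ _) (s.i ≫ biprod.inr ▷ _),
    biprod.lift (biprod.fst ▷ _ ≫ r.r) (biprod.snd ▷ _ ≫ s.r), ?_⟩⟩⟩
  apply biprod.hom_ext' <;> apply biprod.hom_ext <;> simp [← comp_whiskerRight_assoc]

/-! ### Cocycles and cohomology classes -/

section Represents

/-- The element `x` of the homology of `S` is the class of the cycle `f`. -/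
def IsClassOf {S : ShortComplex (ModuleCat.{u} R)} (x : S.homology) (f : S.X₂) : Prop :=
  ∃ z : S.cycles, S.homologyπ z = x ∧ S.iCycles z = f

namespace IsClassOf

variable {S S' : ShortComplex (ModuleCat.{u} R)}

lemma exists_rep (x : S.homology) : ∃ f, IsClassOf x f := by
  obtain ⟨z, rfl⟩ := (ModuleCat.epi_iff_surjective S.homologyπ).1 inferInstance x
  exact ⟨_, z, rfl, rfl⟩

lemma cocycle {x : S.homology} {f : S.X₂} (h : IsClassOf x f) : S.g f = 0 := by
  obtain ⟨z, -, rfl⟩ := h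
  rw [← ModuleCat.comp_apply, S.iCycles_g]
  rfl

lemma exists_class {f : S.X₂} (hf : S.g f = 0) : ∃ x : S.homology, IsClassOf x f := by
  have hex : (ShortComplex.mk _ _ S.iCycles_g).Exact :=
    ShortComplex.exact_of_f_is_kernel _ S.cyclesIsKernel
  obtain ⟨z, hz⟩ := (ShortComplex.moduleCat_exact_iff _).1 hex f hf
  exact ⟨_, z, rfl, hz⟩

lemma eq_zero_iff {x : S.homology} {f : S.X₂} (h : IsClassOf x f) : x = 0 ↔ ∃ g, S.f g = f := by
  obtain ⟨z, rfl, rfl⟩ := h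
  have hex : (ShortComplex.mk _ _ S.toCycles_comp_homologyπ).Exact :=
    ShortComplex.exact_of_g_is_cokernel _ S.homologyIsCokernel
  constructor
  · intro hz
    obtain ⟨g, hg⟩ := (ShortComplex.moduleCat_exact_iff _).1 hex z hz
    refine ⟨g, ?_⟩
    rw [← hg]
    change S.f g = (S.toCycles ≫ S.iCycles) g
    rw [S.toCycles_i]
  · rintro ⟨g, hg⟩
    have : S.toCycles g = z := by
      apply (ModuleCat.mono_iff_injective S.iCycles).1 inferInstance
      rw [← hg]
      change (S.toCycles ≫ S.iCycles) g = _
      rw [S.toCycles_i]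
    rw [← this]
    change (S.toCycles ≫ S.homologyπ) g = 0
    rw [S.toCycles_comp_homologyπ]
    rfl

lemma sub {x y : S.homology} {f g : S.X₂} (hx : IsClassOf x f) (hy : IsClassOf y g) :
    IsClassOf (x - y) (f - g) := by
  obtain ⟨z, rfl, rfl⟩ := hx
  obtain ⟨w, rfl, rfl⟩ := hy
  exact ⟨z - w, map_sub _ _ _, map_sub _ _ _⟩

lemma map (φ : S ⟶ S') {x : S.homology} {f : S.X₂} (h : IsClassOf x f) :
    IsClassOf (ShortComplex.homologyMap φ x) (φ.τ₂ f) := by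
  obtain ⟨z, rfl, rfl⟩ := h
  refine ⟨ShortComplex.cyclesMap φ z, ?_, ?_⟩
  · change (ShortComplex.cyclesMap φ ≫ S'.homologyπ) z = (S.homologyπ ≫ _) z
    rw [ShortComplex.homologyπ_naturality]
  · change (ShortComplex.cyclesMap φ ≫ S'.iCycles) z = (S.iCycles ≫ _) z
    rw [ShortComplex.cyclesMap_i]

end IsClassOf

variable {ι : Type*} {c : ComplexShape ι} {C D : HomologicalComplex (Rep.{u} R G) c}
  {M : Rep.{u} R G}

/-- The element `x` of `H^i Hom_{RG}(C, M)` is the class of the cocycle `f`. -/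
def Represents {i : ι} (x : (cohomology C i).obj M) (f : C.X i ⟶ M) : Prop :=
  IsClassOf (S := ((homComplex C).obj M).sc i) x f

namespace Represents

variable {i : ι}

lemma exists_rep (x : (cohomology C i).obj M) : ∃ f, Represents x f :=
  IsClassOf.exists_rep (S := ((homComplex C).obj M).sc i) x

lemma cocycle {x : (cohomology C i).obj M} {f : C.X i ⟶ M} (h : Represents x f) {k : ι}
    (hk : c.Rel k i) : C.d k i ≫ f = 0 := by
  have := IsClassOf.cocycle h
  obtain rfl : c.symm.next i = k := c.symm.next_eq' hk
  exact this

lemma exists_class {f : C.X i ⟶ M} (hf : ∀ k, c.Rel k i → C.d k i ≫ f = 0) :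
    ∃ x : (cohomology C i).obj M, Represents x f := by
  refine IsClassOf.exists_class (S := ((homComplex C).obj M).sc i) (f := f) ?_
  change C.d (c.symm.next i) i ≫ f = 0
  by_cases h : c.symm.Rel i (c.symm.next i)
  · exact hf _ h
  · rw [C.shape _ _ h, zero_comp]

lemma eq_zero_iff {x : (cohomology C i).obj M} {f : C.X i ⟶ M} (h : Represents x f) {j : ι}
    (hj : c.Rel i j) : x = 0 ↔ ∃ g : C.X j ⟶ M, C.d i j ≫ g = f := by
  obtain rfl : c.symm.prev i = j := c.symm.prev_eq' hj
  exact IsClassOf.eq_zero_iff h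

lemma sub {x y : (cohomology C i).obj M} {f g : C.X i ⟶ M} (hx : Represents x f)
    (hy : Represents y g) : Represents (x - y) (f - g) :=
  IsClassOf.sub hx hy

lemma eq_of_sub {x y : (cohomology C i).obj M} {f g : C.X i ⟶ M} (hx : Represents x f)
    (hy : Represents y g) {j : ι} (hj : c.Rel i j) (s : C.X j ⟶ M) (hs : C.d i j ≫ s = f - g) :
    x = y :=
  sub_eq_zero.1 (((hx.sub hy).eq_zero_iff hj).2 ⟨s, hs⟩)

lemma map (φ : C ⟶ D) {x : (cohomology D i).obj M} {f : D.X i ⟶ M} (h : Represents x f) :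
    Represents ((cohomologyMap φ i).app M x) (φ.f i ≫ f) :=
  IsClassOf.map ((HomologicalComplex.shortComplexFunctor _ _ i).map ((homComplexMap φ).app M)) h

end Represents

section ShiftMap

variable {m₂ m₁ m₀ n₂ n₁ n₀ : ι} (hm₂ : c.Rel m₂ m₁) (hm₁ : c.Rel m₁ m₀)
  (hn₂ : c.Rel n₂ n₁) (hn₁ : c.Rel n₁ n₀) (p₂ : C.X m₂ ⟶ D.X n₂) (p₁ : C.X m₁ ⟶ D.X n₁)
  (p₀ : C.X m₀ ⟶ D.X n₀) (h₂ : p₂ ≫ D.d n₂ n₁ = C.d m₂ m₁ ≫ p₁)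
  (h₁ : p₁ ≫ D.d n₁ n₀ = C.d m₁ m₀ ≫ p₀)

/-- Precomposition with maps from `C` to `D` in three consecutive degrees. -/
def homShortComplexMap :
    homComplex D ⋙ HomologicalComplex.shortComplexFunctor' _ c.symm n₀ n₁ n₂ ⟶
      homComplex C ⋙ HomologicalComplex.shortComplexFunctor' _ c.symm m₀ m₁ m₂ where
  app M :=
    { τ₁ := ((linearYoneda R (Rep.{u} R G)).obj M).map p₀.op
      τ₂ := ((linearYoneda R (Rep.{u} R G)).obj M).map p₁.op
      τ₃ := ((linearYoneda R (Rep.{u} R G)).obj M).map p₂.op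
      comm₁₂ := by
        change ((linearYoneda R (Rep.{u} R G)).obj M).map p₀.op ≫
          ((linearYoneda R (Rep.{u} R G)).obj M).map (C.d m₁ m₀).op =
          ((linearYoneda R (Rep.{u} R G)).obj M).map (D.d n₁ n₀).op ≫
          ((linearYoneda R (Rep.{u} R G)).obj M).map p₁.op
        rw [← Functor.map_comp, ← Functor.map_comp, ← op_comp, ← op_comp, h₁]
      comm₂₃ := by
        change ((linearYoneda R (Rep.{u} R G)).obj M).map p₁.op ≫
          ((linearYoneda R (Rep.{u} R G)).obj M).map (C.d m₂ m₁).op =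
          ((linearYoneda R (Rep.{u} R G)).obj M).map (D.d n₂ n₁).op ≫
          ((linearYoneda R (Rep.{u} R G)).obj M).map p₂.op
        rw [← Functor.map_comp, ← Functor.map_comp, ← op_comp, ← op_comp, h₂] }
  naturality M M' g := by
    ext : 1
    · exact (((linearYoneda R (Rep.{u} R G)).map g).naturality p₀.op).symm
    · exact (((linearYoneda R (Rep.{u} R G)).map g).naturality p₁.op).symm
    · exact (((linearYoneda R (Rep.{u} R G)).map g).naturality p₂.op).symm

/-- The natural transformation `H^n Hom_{RG}(D, -) ⟶ H^m Hom_{RG}(C, -)` given by maps from `C` to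
`D` in three consecutive degrees. -/
def cohomologyShiftMap : cohomology D n₁ ⟶ cohomology C m₁ :=
  Functor.whiskerLeft (homComplex D)
    (Functor.whiskerRight (HomologicalComplex.natIsoSc' (ModuleCat.{u} R) c.symm n₀ n₁ n₂
      (c.symm.prev_eq' hn₁) (c.symm.next_eq' hn₂)).hom (ShortComplex.homologyFunctor _)) ≫
  Functor.whiskerRight (homShortComplexMap p₂ p₁ p₀ h₂ h₁) (ShortComplex.homologyFunctor _) ≫
  Functor.whiskerLeft (homComplex C)
    (Functor.whiskerRight (HomologicalComplex.natIsoSc' (ModuleCat.{u} R) c.symm m₀ m₁ m₂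
      (c.symm.prev_eq' hm₁) (c.symm.next_eq' hm₂)).inv (ShortComplex.homologyFunctor _))

lemma Represents.shiftMap {x : (cohomology D n₁).obj M} {f : D.X n₁ ⟶ M} (h : Represents x f) :
    Represents ((cohomologyShiftMap hm₂ hm₁ hn₂ hn₁ p₂ p₁ p₀ h₂ h₁).app M x) (p₁ ≫ f) :=
  IsClassOf.map ((HomologicalComplex.natIsoSc' (ModuleCat.{u} R) c.symm m₀ m₁ m₂
      (c.symm.prev_eq' hm₁) (c.symm.next_eq' hm₂)).inv.app _)
    (IsClassOf.map ((homShortComplexMap p₂ p₁ p₀ h₂ h₁).app M)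
      (IsClassOf.map ((HomologicalComplex.natIsoSc' (ModuleCat.{u} R) c.symm n₀ n₁ n₂
        (c.symm.prev_eq' hn₁) (c.symm.next_eq' hn₂)).hom.app _) h))

end ShiftMap

end Represents

/-! ### Exactness of `Hom` complexes in terms of morphisms -/

section Exactness

variable {ι : Type*} {c : ComplexShape ι}

/-- Every cocycle `C_i ⟶ Q` of `Hom_{RG}(C, Q)` is a coboundary. -/
def CoHomExact (C : HomologicalComplex (Rep.{u} R G) c) (Q : Rep.{u} R G) : Prop :=
  ∀ ⦃k i j : ι⦄, c.Rel k i → c.Rel i j → ∀ f : C.X i ⟶ Q, C.d k i ≫ f = 0 →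
    ∃ g : C.X j ⟶ Q, C.d i j ≫ g = f

lemma acyclic_homComplex_iff (hc : ∀ i, ∃ k, c.Rel k i) (hc' : ∀ i, ∃ j, c.Rel i j)
    (C : HomologicalComplex (Rep.{u} R G) c) (Q : Rep.{u} R G) :
    ((homComplex C).obj Q).Acyclic ↔ CoHomExact C Q := by
  have key : ∀ {k i j : ι}, c.Rel k i → c.Rel i j → (((homComplex C).obj Q).ExactAt i ↔
      ∀ f : C.X i ⟶ Q, C.d k i ≫ f = 0 → ∃ g : C.X j ⟶ Q, C.d i j ≫ g = f) := by
    intro k i j hk hj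
    rw [HomologicalComplex.exactAt_iff' _ j i k (c.symm.prev_eq' hj) (c.symm.next_eq' hk),
      ShortComplex.moduleCat_exact_iff]
    rfl
  constructor
  · intro h k i j hk hj
    exact (key hk hj).1 (h i)
  · intro h i
    obtain ⟨k, hk⟩ := hc i
    obtain ⟨j, hj⟩ := hc' i
    exact (key hk hj).2 (h hk hj)

lemma acyclic_coyoneda_iff (hc : ∀ j, ∃ i, c.Rel i j) (Q : Rep.{u} R G)
    (C : HomologicalComplex (Rep.{u} R G) c) :
    ((((linearCoyoneda R (Rep.{u} R G)).obj (Opposite.op Q)).mapHomologicalComplex c).obj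
      C).Acyclic ↔ HomExact Q C := by
  have key : ∀ {i j : ι}, c.Rel i j →
      (((((linearCoyoneda R (Rep.{u} R G)).obj (Opposite.op Q)).mapHomologicalComplex c).obj
        C).ExactAt j ↔ ∀ f : Q ⟶ C.X j, f ≫ C.d j (c.next j) = 0 →
          ∃ g : Q ⟶ C.X i, g ≫ C.d i j = f) := by
    intro i j hij
    rw [HomologicalComplex.exactAt_iff' _ i j (c.next j) (c.prev_eq' hij) rfl,
      ShortComplex.moduleCat_exact_iff]
    rfl
  constructor
  · intro h i j hij f hf
    refine (key hij).1 (h j) f ?_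
    by_cases hk : c.Rel j (c.next j)
    · exact hf _ hk
    · rw [C.shape _ _ hk, comp_zero]
  · intro h j
    obtain ⟨i, hij⟩ := hc j
    refine (key hij).2 fun f hf => h hij f fun k hk => ?_
    obtain rfl := c.next_eq' hk
    exact hf

lemma FCompleteResolution.IsFStrong.coHomExact {M : Rep.{u} R G} {T : FCompleteResolution M}
    (hT : T.IsFStrong) {Q : Rep.{u} R G} (hQ : IsFProjective Q) : CoHomExact T.cx Q :=
  (acyclic_homComplex_iff (fun i => ⟨i + 1, rfl⟩) (fun i => ⟨i - 1, by simp⟩) _ _).1 (hT Q hQ)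

lemma isFGProper_iff (C : ChainComplex (Rep.{u} R G) ℕ) :
    IsFGProper C ↔ ∀ Q : Rep.{u} R G, IsFGProjective Q → HomExact Q C :=
  forall₂_congr fun Q _ => acyclic_coyoneda_iff (fun j => ⟨j + 1, rfl⟩) Q C

end Exactness

/-! ### Cohomology classes of `ℕ`-graded complexes -/

section ToInt

variable {C D : ChainComplex (Rep.{u} R G) ℕ} {M : Rep.{u} R G} {n : ℕ}

lemma toInt_d (C : ChainComplex (Rep.{u} R G) ℕ) (i j : ℕ) :
    (toInt C).d (i : ℤ) (j : ℤ) ≫ (toIntXIso C j).hom = (toIntXIso C i).hom ≫ C.d i j := by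
  have := C.extend_d_eq natToInt (i' := (i : ℤ)) (j' := (j : ℤ)) (i := i) (j := j) rfl rfl
  simp [this, toIntXIso]

lemma toIntMap_f (φ : C ⟶ D) (i : ℕ) :
    (toIntMap φ).f (i : ℤ) ≫ (toIntXIso D i).hom = (toIntXIso C i).hom ≫ φ.f i := by
  have := HomologicalComplex.extendMap_f φ natToInt (i' := (i : ℤ)) (i := i) rfl
  simp [this, toIntXIso]

/-- The element `x` of `H^n Hom_{RG}(C, M)` is the class of the cocycle `f`. -/
def NatRepresents (x : (cohomology (toInt C) (n : ℤ)).obj M) (f : C.X n ⟶ M) : Prop :=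
  Represents x ((toIntXIso C n).hom ≫ f)

namespace NatRepresents

lemma exists_rep (x : (cohomology (toInt C) (n : ℤ)).obj M) : ∃ f, NatRepresents x f := by
  obtain ⟨f, hf⟩ := Represents.exists_rep x
  exact ⟨(toIntXIso C n).inv ≫ f, by rwa [NatRepresents, Iso.hom_inv_id_assoc]⟩

lemma cocycle {x : (cohomology (toInt C) (n : ℤ)).obj M} {f : C.X n ⟶ M}
    (h : NatRepresents x f) : C.d (n + 1) n ≫ f = 0 := by
  have := Represents.cocycle h (k := ((n + 1 : ℕ) : ℤ)) (by simp)
  rw [← Category.assoc, toInt_d, Category.assoc] at this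
  rwa [← cancel_epi (toIntXIso C (n + 1)).hom, comp_zero]

lemma exists_class {f : C.X n ⟶ M} (hf : C.d (n + 1) n ≫ f = 0) :
    ∃ x : (cohomology (toInt C) (n : ℤ)).obj M, NatRepresents x f := by
  refine Represents.exists_class fun k hk => ?_
  obtain rfl : ((n + 1 : ℕ) : ℤ) = k := by simpa using hk
  rw [← Category.assoc, toInt_d, Category.assoc, hf, comp_zero]

lemma eq_zero_iff {x : (cohomology (toInt C) ((n + 1 : ℕ) : ℤ)).obj M} {f : C.X (n + 1) ⟶ M}
    (h : NatRepresents x f) : x = 0 ↔ ∃ g : C.X n ⟶ M, C.d (n + 1) n ≫ g = f := by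
  rw [Represents.eq_zero_iff h (j := (n : ℤ)) (by simp)]
  constructor
  · rintro ⟨g, hg⟩
    refine ⟨(toIntXIso C n).inv ≫ g, ?_⟩
    rw [← cancel_epi (toIntXIso C (n + 1)).hom, ← hg, ← Category.assoc, ← toInt_d]
    simp
  · rintro ⟨g, rfl⟩
    exact ⟨(toIntXIso C n).hom ≫ g, by rw [← Category.assoc, toInt_d, Category.assoc]⟩

lemma sub {x y : (cohomology (toInt C) (n : ℤ)).obj M} {f g : C.X n ⟶ M}
    (hx : NatRepresents x f) (hy : NatRepresents y g) : NatRepresents (x - y) (f - g) := by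
  have := Represents.sub hx hy
  rwa [← Preadditive.comp_sub] at this

lemma eq_of_sub {x y : (cohomology (toInt C) ((n + 1 : ℕ) : ℤ)).obj M} {f g : C.X (n + 1) ⟶ M}
    (hx : NatRepresents x f) (hy : NatRepresents y g) (s : C.X n ⟶ M)
    (hs : C.d (n + 1) n ≫ s = f - g) : x = y :=
  sub_eq_zero.1 ((hx.sub hy).eq_zero_iff.2 ⟨s, hs⟩)

lemma map (φ : C ⟶ D) {x : (cohomology (toInt D) (n : ℤ)).obj M} {f : D.X n ⟶ M}
    (h : NatRepresents x f) :
    NatRepresents ((cohomologyMap (toIntMap φ) (n : ℤ)).app M x) (φ.f n ≫ f) := by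
  have := Represents.map (toIntMap φ) h
  rwa [← Category.assoc, toIntMap_f, Category.assoc] at this

end NatRepresents

instance : natToInt.IsRelIff :=
  inferInstanceAs (ComplexShape.Embedding.mk' _ _ _ _ _).IsRelIff

/-- The chain map `T ⟶ C` from a `ℤ`-graded complex given by a family of maps in the degrees
`n ≥ 0`. -/
lemma exists_hom_toInt (T : ChainComplex (Rep.{u} R G) ℤ) (θ : ∀ n : ℕ, T.X (n : ℤ) ⟶ C.X n)
    (hθ : ∀ n : ℕ, θ (n + 1) ≫ C.d (n + 1) n = T.d ((n + 1 : ℕ) : ℤ) (n : ℤ) ≫ θ n) :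
    ∃ Θ : T ⟶ toInt C, ∀ n : ℕ, Θ.f (n : ℤ) ≫ (toIntXIso C n).hom = θ n := by
  let φ : T.restriction natToInt ⟶ C :=
    { f := θ
      comm' := by
        rintro _ j rfl
        exact hθ j }
  have hφ : natToInt.HasLift φ := by
    -- The differential into degree `n` comes from `n + 1`, so none enters the range `n ≥ 0` from
    -- outside and the lifting condition is vacuous.
    intro j hj i' hi'
    exact absurd hj (natToInt.not_boundaryGE_next (j := j + 1) rfl)
  refine ⟨natToInt.liftExtend φ hφ, fun n => ?_⟩
  have := natToInt.liftExtend_f φ hφ (i' := (n : ℤ)) (i := n) rfl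
  rw [this]
  change (𝟙 (T.X (n : ℤ)) ≫ θ n ≫ (toIntXIso C n).inv) ≫ (toIntXIso C n).hom = θ n
  simp

end ToInt

/-! ### Constructing `𝔉_G`-projectives -/

/-- A chain complex with a contraction, given degreewise. -/
def homotopyOfContraction {V : Type*} [Category* V] [Preadditive V] (K : ChainComplex V ℕ)
    (s : ∀ n, K.X n ⟶ K.X (n + 1)) (h₀ : s 0 ≫ K.d 1 0 = 𝟙 _)
    (h : ∀ n, K.d (n + 1) n ≫ s n + s (n + 1) ≫ K.d (n + 2) (n + 1) = 𝟙 _) :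
    Homotopy (𝟙 K) 0 where
  hom i j := if hij : i + 1 = j then s i ≫ eqToHom (by rw [hij]) else 0
  zero i j hij := dif_neg hij
  comm i := by
    cases i with
    | zero =>
      rw [Homotopy.prevD_chainComplex, Homotopy.dNext_zero_chainComplex]
      simp [h₀]
    | succ n =>
      rw [Homotopy.prevD_chainComplex, Homotopy.dNext_succ_chainComplex]
      simp [h]

/-- A `ℤ`-graded `𝔉`-split acyclic complex of `𝔉`-projectives which stays exact under
`Hom_{RG}(-, Q)` for all `𝔉`-projectives `Q`. -/
structure IsTotallyFAcyclic (S : ChainComplex (Rep.{u} R G) ℤ) : Prop where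
  projective : ∀ i, IsFProjective (S.X i)
  contractible : IsFContractible S
  coHomExact : ∀ Q : Rep.{u} R G, IsFProjective Q → CoHomExact S Q

lemma FCompleteResolution.IsFStrong.isTotallyFAcyclic {M : Rep.{u} R G}
    {T : FCompleteResolution M} (hT : T.IsFStrong) : IsTotallyFAcyclic T.cx :=
  ⟨T.projective, T.split.2, fun _ hQ => hT.coHomExact hQ⟩

/-! ### Cokernels of totally `𝔉`-acyclic complexes -/

section Truncation

variable (S : ChainComplex (Rep.{u} R G) ℤ)

/-- The brutal truncation of a `ℤ`-graded complex to the degrees `≥ 0`. -/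
@[simps]
def truncNat : ChainComplex (Rep.{u} R G) ℕ where
  X n := S.X (n : ℤ)
  d i j := S.d (i : ℤ) (j : ℤ)
  shape i j hij := S.shape _ _ (by simp only [ComplexShape.down_Rel] at hij ⊢; omega)
  d_comp_d' _ _ _ _ _ := S.d_comp_d _ _ _

/-- The truncation of `S`, augmented to the cokernel of its lowest differential. -/
@[simps]
def truncAugmented : AugmentedComplex (cokernel (S.d ((1 : ℕ) : ℤ) ((0 : ℕ) : ℤ))) where
  cx := truncNat S
  ε := cokernel.π (S.d ((1 : ℕ) : ℤ) ((0 : ℕ) : ℤ))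
  d_comp_ε := cokernel.condition (S.d ((1 : ℕ) : ℤ) ((0 : ℕ) : ℤ))

variable {S}

/-- The differential `S_0 ⟶ S_{-1}` factors as `π ≫ ι` through the cokernel. Following `ι` by the
contraction `σ : S_{-1} ⟶ S_0` gives a section of `π`, because `π ι σ = 1 - σ d` and `d π = 0`. In
higher degrees the contraction of `S` is kept. -/
lemma isFContractible_truncAugmented (hS : IsFContractible S) :
    IsFContractible (truncAugmented S).augmented := by
  intro H hH
  obtain ⟨h⟩ := hS H hH
  let F := Rep.resFunctor (k := R) H.subtype
  let σ : ∀ m n : ℤ, F.obj (S.X m) ⟶ F.obj (S.X n) := h.hom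
  have hcomm : ∀ n : ℤ, F.map (S.d n (n - 1)) ≫ σ (n - 1) n +
      σ n (n + 1) ≫ F.map (S.d (n + 1) n) = 𝟙 (F.obj (S.X n)) := by
    intro n
    have := h.comm n
    rw [dNext_eq _ (show (ComplexShape.down ℤ).Rel n (n - 1) by simp),
      prevD_eq _ (show (ComplexShape.down ℤ).Rel (n + 1) n by simp)] at this
    simp only [HomologicalComplex.zero_f, add_zero] at this
    exact this.symm
  let π := cokernel.π (S.d ((1 : ℕ) : ℤ) ((0 : ℕ) : ℤ))
  let ι : cokernel (S.d ((1 : ℕ) : ℤ) ((0 : ℕ) : ℤ)) ⟶ S.X (0 - 1) :=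
    cokernel.desc _ (S.d 0 (0 - 1)) (S.d_comp_d _ _ _)
  have hι : π ≫ ι = S.d 0 (0 - 1) := cokernel.π_desc _ _ _
  have hπ : F.map (S.d (0 + 1) 0) ≫ F.map π = 0 := by
    rw [← F.map_comp]
    exact (congrArg F.map (cokernel.condition (S.d ((1 : ℕ) : ℤ) ((0 : ℕ) : ℤ)))).trans
      (F.map_zero _ _)
  refine ⟨homotopyOfContraction _ (fun n => match n with
    | 0 => F.map ι ≫ σ (0 - 1) 0
    | n + 1 => σ (n : ℤ) ((n + 1 : ℕ) : ℤ)) ?_ ?_⟩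
  · change (F.map ι ≫ σ (0 - 1) 0) ≫ F.map π = 𝟙 _
    have : Epi (F.map π) := by
      rw [Rep.epi_iff_surjective]
      exact (Rep.epi_iff_surjective π).1 inferInstance
    have key : F.map π ≫ F.map ι ≫ σ (0 - 1) 0 = 𝟙 _ - σ 0 (0 + 1) ≫ F.map (S.d (0 + 1) 0) := by
      rw [← F.map_comp_assoc, hι]
      exact eq_sub_of_add_eq (hcomm 0)
    rw [← cancel_epi (F.map π), ← Category.assoc, key, Preadditive.sub_comp, Category.assoc, hπ]
    simp
  · intro n
    cases n with
    | zero =>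
      change F.map π ≫ F.map ι ≫ σ (0 - 1) 0 + σ 0 (0 + 1) ≫ F.map (S.d (0 + 1) 0) = _
      rw [← F.map_comp_assoc, hι]
      exact hcomm 0
    | succ n =>
      have := hcomm ((n + 1 : ℕ) : ℤ)
      have e : ((n + 1 : ℕ) : ℤ) - 1 = n := by simp
      rw [e] at this
      exact this

/-- The cokernels in a totally `𝔉`-acyclic complex are `𝔉_G`-projective. -/
theorem IsTotallyFAcyclic.isFGProjective_cokernel (hS : IsTotallyFAcyclic S) (i : ℤ) :
    IsFGProjective (cokernel (S.d (i + 1) i)) := by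
  -- `S` is itself a complete resolution of the cokernel of `S_1 ⟶ S_0`. Its truncation serves as
  -- the resolution, and the two coincide from degree `0` on.
  refine ⟨_, { cx := S, projective := hS.projective,
               split := hS.contractible.isFSplit (fun i => ⟨i + 1, rfl⟩),
               res := { toAugmentedComplex := truncAugmented S
                        projective := fun i => hS.projective i
                        split := (isFContractible_truncAugmented hS.contractible).isFSplit
                          (fun j => ⟨j + 1, rfl⟩) },
               index := 0, iso := fun i _ => Iso.refl _, comm := fun i _ => ?_ }, i, ?_,
            ⟨Iso.refl _⟩⟩
  · exact (Category.comp_id _).trans (Category.id_comp _).symm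
  · intro Q hQ
    exact (acyclic_homComplex_iff (fun i => ⟨i + 1, rfl⟩) (fun i => ⟨i - 1, by simp⟩) _ _).2
      (hS.coHomExact Q hQ)

end Truncation

lemma IsFGProjective.of_iso {Q Q' : Rep.{u} R G} (e : Q ≅ Q') (h : IsFGProjective Q') :
    IsFGProjective Q := by
  obtain ⟨M, T, i, hT, ⟨e'⟩⟩ := h
  exact ⟨M, T, i, hT, ⟨e ≪≫ e'⟩⟩

lemma IsTotallyFAcyclic.biprod {S S' : ChainComplex (Rep.{u} R G) ℤ} (hS : IsTotallyFAcyclic S)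
    (hS' : IsTotallyFAcyclic S') : IsTotallyFAcyclic (S ⊞ S') where
  projective i := ((hS.projective i).biprod (hS'.projective i)).of_retract
    (HomologicalComplex.biprodXIso S S' i).retract
  contractible H hH := by
    obtain ⟨h⟩ := hS.contractible H hH
    obtain ⟨h'⟩ := hS'.contractible H hH
    let F := (Rep.resFunctor (k := R) H.subtype).mapHomologicalComplex (ComplexShape.down ℤ)
    have e : 𝟙 (F.obj (S ⊞ S')) =
        F.map biprod.fst ≫ 𝟙 (F.obj S) ≫ F.map biprod.inl +
        F.map biprod.snd ≫ 𝟙 (F.obj S') ≫ F.map biprod.inr := by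
      rw [Category.id_comp, Category.id_comp, ← F.map_comp, ← F.map_comp, ← F.map_add,
        biprod.total, F.map_id]
    exact ⟨(Homotopy.ofEq e).trans
      ((((h.compRight (F.map biprod.inl)).compLeft (F.map biprod.fst)).add
        ((h'.compRight (F.map biprod.inr)).compLeft (F.map biprod.snd))).trans
        (Homotopy.ofEq (by simp)))⟩
  coHomExact Q hQ k i j hk hj f hf := by
    obtain ⟨g, hg⟩ := hS.coHomExact Q hQ hk hj ((biprod.inl : S ⟶ S ⊞ S').f i ≫ f) (by
      rw [← HomologicalComplex.Hom.comm_assoc, hf, comp_zero])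
    obtain ⟨g', hg'⟩ := hS'.coHomExact Q hQ hk hj ((biprod.inr : S' ⟶ S ⊞ S').f i ≫ f) (by
      rw [← HomologicalComplex.Hom.comm_assoc, hf, comp_zero])
    refine ⟨(biprod.fst : S ⊞ S' ⟶ S).f j ≫ g + (biprod.snd : S ⊞ S' ⟶ S').f j ≫ g', ?_⟩
    have htot := congrArg (fun φ => φ.f i) (biprod.total (X := S) (Y := S'))
    simp only [HomologicalComplex.add_f_apply, HomologicalComplex.comp_f,
      HomologicalComplex.id_f] at htot
    rw [Preadditive.comp_add, ← HomologicalComplex.Hom.comm_assoc,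
      ← HomologicalComplex.Hom.comm_assoc, hg, hg', ← Category.assoc, ← Category.assoc,
      ← Preadditive.add_comp, htot, Category.id_comp]

/-- Cokernels of differentials commute with binary biproducts. -/
def cokernelBiprodIso (S S' : ChainComplex (Rep.{u} R G) ℤ) (i j : ℤ) :
    cokernel ((S ⊞ S').d i j) ≅ cokernel (S.d i j) ⊞ cokernel (S'.d i j) where
  hom := cokernel.desc _
    (biprod.lift ((biprod.fst : S ⊞ S' ⟶ S).f j ≫ cokernel.π _)
      ((biprod.snd : S ⊞ S' ⟶ S').f j ≫ cokernel.π _)) (by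
      apply biprod.hom_ext <;> simp [← HomologicalComplex.Hom.comm_assoc])
  inv := biprod.desc
    (cokernel.desc _ ((biprod.inl : S ⟶ S ⊞ S').f j ≫ cokernel.π _) (by
      rw [← HomologicalComplex.Hom.comm_assoc, cokernel.condition, comp_zero]))
    (cokernel.desc _ ((biprod.inr : S' ⟶ S ⊞ S').f j ≫ cokernel.π _) (by
      rw [← HomologicalComplex.Hom.comm_assoc, cokernel.condition, comp_zero]))
  hom_inv_id := by
    rw [← cancel_epi (cokernel.π _)]
    apply HomologicalComplex.biprodX_ext_from <;> simp [biprod.lift_desc]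
  inv_hom_id := by
    apply biprod.hom_ext' <;> rw [← cancel_epi (cokernel.π _)] <;> apply biprod.hom_ext <;> simp

/-! ### Contractible complexes built from one `𝔉`-projective -/

section Doubled

variable (P : Rep.{u} R G)

/-- The contractible complex `⋯ ⟶ P ⊞ P ⟶ P ⊞ P ⟶ ⋯` with differential `(a, b) ↦ (b, 0)`. -/
def doubled : ChainComplex (Rep.{u} R G) ℤ where
  X _ := P ⊞ P
  d i j := if j + 1 = i then biprod.snd ≫ biprod.inl else 0
  shape _ _ hij := if_neg hij
  d_comp_d' i j k hij hjk := by
    rw [if_pos (show j + 1 = i from hij), if_pos (show k + 1 = j from hjk)]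
    simp

namespace doubled

/-- The first inclusion. -/
def inl (i : ℤ) : P ⟶ (doubled P).X i := biprod.inl (X := P) (Y := P)

/-- The second inclusion. -/
def inr (i : ℤ) : P ⟶ (doubled P).X i := biprod.inr (X := P) (Y := P)

/-- The first projection. -/
def fst (i : ℤ) : (doubled P).X i ⟶ P := biprod.fst (X := P) (Y := P)

/-- The second projection. -/
def snd (i : ℤ) : (doubled P).X i ⟶ P := biprod.snd (X := P) (Y := P)

@[simp]
lemma inl_fst (i : ℤ) : inl P i ≫ fst P i = 𝟙 P := biprod.inl_fst

@[simp]
lemma inl_fst_assoc (i : ℤ) {Q : Rep.{u} R G} (f : P ⟶ Q) :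
    inl P i ≫ fst P i ≫ f = f := by
  rw [← Category.assoc, inl_fst, Category.id_comp]

@[simp]
lemma inl_snd (i : ℤ) : inl P i ≫ snd P i = 0 := biprod.inl_snd

@[simp]
lemma inl_snd_assoc (i : ℤ) {Q : Rep.{u} R G} (f : P ⟶ Q) :
    inl P i ≫ snd P i ≫ f = 0 := by
  rw [← Category.assoc, inl_snd, zero_comp]

@[simp]
lemma inr_fst (i : ℤ) : inr P i ≫ fst P i = 0 := biprod.inr_fst

@[simp]
lemma inr_snd (i : ℤ) : inr P i ≫ snd P i = 𝟙 P := biprod.inr_snd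

@[simp]
lemma inr_snd_assoc (i : ℤ) {Q : Rep.{u} R G} (f : P ⟶ Q) :
    inr P i ≫ snd P i ≫ f = f := by
  rw [← Category.assoc, inr_snd, Category.id_comp]

lemma total (i : ℤ) : fst P i ≫ inl P i + snd P i ≫ inr P i = 𝟙 _ := biprod.total

lemma d_eq {i j : ℤ} (h : j + 1 = i) : (doubled P).d i j = snd P i ≫ inl P j := if_pos h

variable {P} in
lemma hom_ext {i : ℤ} {Q : Rep.{u} R G} {f g : (doubled P).X i ⟶ Q}
    (h₁ : inl P i ≫ f = inl P i ≫ g) (h₂ : inr P i ≫ f = inr P i ≫ g) : f = g :=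
  biprod.hom_ext' _ _ h₁ h₂

/-- The contraction of `doubled P`. -/
def homotopy : Homotopy (𝟙 (doubled P)) 0 where
  hom i j := if i + 1 = j then fst P i ≫ inr P j else 0
  zero _ _ hij := if_neg hij
  comm i := by
    rw [dNext_eq _ (show (ComplexShape.down ℤ).Rel i (i - 1) by simp),
      prevD_eq _ (show (ComplexShape.down ℤ).Rel (i + 1) i by simp),
      d_eq P (sub_add_cancel i 1), d_eq P rfl]
    simp [← total P i, add_comm]

end doubled

variable {P}

lemma isTotallyFAcyclic_doubled (hP : IsFProjective P) : IsTotallyFAcyclic (doubled P) where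
  projective _ := hP.biprod hP
  contractible H _ := ⟨(Homotopy.ofEq (CategoryTheory.Functor.map_id _ _).symm).trans
    (((Rep.resFunctor (k := R) H.subtype).mapHomotopy (doubled.homotopy P)).trans
      (Homotopy.ofEq (Functor.map_zero _ _ _)))⟩
  coHomExact Q _ k i j hk hj f hf := by
    refine ⟨doubled.fst P j ≫ doubled.inr P i ≫ f, ?_⟩
    rw [doubled.d_eq P hk] at hf
    rw [doubled.d_eq P hj]
    have h : doubled.inl P i ≫ f = 0 := by
      simpa using congrArg (fun g => doubled.inr P k ≫ g) hf
    apply doubled.hom_ext <;> simp [h]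

variable (P) in
/-- The cokernels in `doubled P` are `P`. -/
def doubled.cokernelIso (i : ℤ) : cokernel ((doubled P).d (i + 1) i) ≅ P where
  hom := cokernel.desc _ (doubled.snd P i) (by
    rw [doubled.d_eq P rfl, Category.assoc, doubled.inl_snd, comp_zero])
  inv := doubled.inr P i ≫ cokernel.π ((doubled P).d (i + 1) i)
  hom_inv_id := by
    have h : doubled.inl P i ≫ cokernel.π ((doubled P).d (i + 1) i) = 0 := by
      have := congrArg (fun g => doubled.inr P (i + 1) ≫ g)
        (cokernel.condition ((doubled P).d (i + 1) i))
      simpa only [doubled.d_eq P (rfl : i + 1 = i + 1), Category.assoc,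
        doubled.inr_snd_assoc, comp_zero] using this
    rw [← cancel_epi (cokernel.π _), cokernel.π_desc_assoc, Category.comp_id]
    apply doubled.hom_ext
    · rw [doubled.inl_snd_assoc, h]
    · rw [doubled.inr_snd_assoc]
  inv_hom_id := by rw [Category.assoc, cokernel.π_desc, doubled.inr_snd]

/-- The doubled complex is contracted over `RG` itself, so it stays contractible under restriction
and under `Hom` into any module. All its cokernels are `P`. -/
theorem IsFProjective.isFGProjective (hP : IsFProjective P) : IsFGProjective P :=
  IsFGProjective.of_iso (doubled.cokernelIso P 0).symm
    ((isTotallyFAcyclic_doubled hP).isFGProjective_cokernel 0)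

/-- `𝔉_G`-projectives are closed under adding `𝔉`-projectives. -/
theorem IsFGProjective.biprod_of_isFProjective {A : Rep.{u} R G} (hA : IsFGProjective A)
    (hP : IsFProjective P) : IsFGProjective (A ⊞ P) := by
  obtain ⟨M, T, i, hT, ⟨e⟩⟩ := hA
  -- Every cokernel of the doubled complex is `P`, so adding it to `T` adds `P` to the cokernel in
  -- the required degree `i`.
  have hS := hT.isTotallyFAcyclic.biprod (isTotallyFAcyclic_doubled hP)
  exact IsFGProjective.of_iso (biprod.mapIso e (doubled.cokernelIso P i).symm ≪≫
    (cokernelBiprodIso T.cx (doubled P) (i + 1) i).symm) (hS.isFGProjective_cokernel i)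

end Doubled

/-! ### The cone of a map from a complete resolution to a resolution -/

section Cone

variable {T : ChainComplex (Rep.{u} R G) ℤ} {P : ChainComplex (Rep.{u} R G) ℕ}

variable (T) in
/-- The cokernel of the differential `T_1 ⟶ T_0`. -/
abbrev coker₀ : Rep.{u} R G := cokernel (T.d ((0 + 1 : ℕ) : ℤ) ((0 : ℕ) : ℤ))

variable (T) in
/-- The projection of `T_0` onto the cokernel of `T_1 ⟶ T_0`. -/
abbrev coker₀π : T.X ((0 : ℕ) : ℤ) ⟶ coker₀ T := cokernel.π _

variable (T P) in
/-- A family of maps `T_n ⟶ P_n` for `n ≥ 0`, anticommuting with the differentials. -/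
structure AntiMap where
  τ : ∀ n : ℕ, T.X (n : ℤ) ⟶ P.X n
  comm : ∀ n : ℕ, τ (n + 1) ≫ P.d (n + 1) n = -(T.d ((n + 1 : ℕ) : ℤ) (n : ℤ) ≫ τ n)

namespace AntiMap

variable (t : AntiMap T P)

/-- The terms of the cone. -/
def coneX (_ : AntiMap T P) : ℕ → Rep.{u} R G
  | 0 => P.X 0 ⊞ coker₀ T
  | n + 1 => P.X (n + 1) ⊞ T.X (n : ℤ)

/-- The differentials of the cone. -/
def coneD : ∀ n : ℕ, t.coneX (n + 1) ⟶ t.coneX n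
  | 0 => biprod.desc (X := P.X 1) (Y := T.X ((0 : ℕ) : ℤ)) (P.d 1 0 ≫ biprod.inl)
      (t.τ 0 ≫ biprod.inl + coker₀π T ≫ biprod.inr)
  | n + 1 => biprod.desc (X := P.X (n + 2)) (Y := T.X ((n + 1 : ℕ) : ℤ))
      (P.d (n + 2) (n + 1) ≫ biprod.inl)
      (t.τ (n + 1) ≫ biprod.inl + T.d ((n + 1 : ℕ) : ℤ) (n : ℤ) ≫ biprod.inr)

/-- The off-diagonal entry of the composite is `s ≫ p' + q ≫ s'`. Making the family anticommute
kills it without putting a sign on either diagonal differential. -/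
lemma biprod_triangular_comp_eq_zero {A₀ A₁ A₂ B₀ B₁ B₂ : Rep.{u} R G} (p : A₂ ⟶ A₁)
    (p' : A₁ ⟶ A₀) (s : B₂ ⟶ A₁) (s' : B₁ ⟶ A₀) (q : B₂ ⟶ B₁) (q' : B₁ ⟶ B₀) (hp : p ≫ p' = 0)
    (hs : s ≫ p' = -(q ≫ s')) (hq : q ≫ q' = 0) :
    (biprod.desc (p ≫ biprod.inl) (s ≫ biprod.inl + q ≫ biprod.inr) : A₂ ⊞ B₂ ⟶ A₁ ⊞ B₁) ≫
      (biprod.desc (p' ≫ biprod.inl) (s' ≫ biprod.inl + q' ≫ biprod.inr) :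
        A₁ ⊞ B₁ ⟶ A₀ ⊞ B₀) = 0 := by
  apply biprod.hom_ext' <;> apply biprod.hom_ext <;> simp [hp, hs, hq]

lemma coneD_comp_coneD : ∀ n : ℕ, t.coneD (n + 1) ≫ t.coneD n = 0
  | 0 => biprod_triangular_comp_eq_zero _ _ _ _ _ _ (P.d_comp_d _ _ _) (t.comm 0)
      (cokernel.condition _)
  | n + 1 => biprod_triangular_comp_eq_zero _ _ _ _ _ _ (P.d_comp_d _ _ _) (t.comm (n + 1))
      (T.d_comp_d _ _ _)

/-- The cone of `t`: it is `P_0 ⊞ coker (T_1 ⟶ T_0)` in degree `0` and `P_{n+1} ⊞ T_n` in degree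
`n + 1`. -/
def cone : ChainComplex (Rep.{u} R G) ℕ :=
  ChainComplex.of t.coneX t.coneD t.coneD_comp_coneD

/-- The inclusion of `P_n`. -/
def inl : ∀ n : ℕ, P.X n ⟶ t.cone.X n
  | 0 => (biprod.inl : P.X 0 ⟶ P.X 0 ⊞ coker₀ T)
  | n + 1 => (biprod.inl : P.X (n + 1) ⟶ P.X (n + 1) ⊞ T.X (n : ℤ))

/-- The projection onto `P_n`. -/
def fst : ∀ n : ℕ, t.cone.X n ⟶ P.X n
  | 0 => (biprod.fst : P.X 0 ⊞ coker₀ T ⟶ P.X 0)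
  | n + 1 => (biprod.fst : P.X (n + 1) ⊞ T.X (n : ℤ) ⟶ P.X (n + 1))

/-- The inclusion of `T_n`. -/
def inr (n : ℕ) : T.X (n : ℤ) ⟶ t.cone.X (n + 1) :=
  (biprod.inr : T.X (n : ℤ) ⟶ P.X (n + 1) ⊞ T.X (n : ℤ))

/-- The projection onto `T_n`. -/
def snd (n : ℕ) : t.cone.X (n + 1) ⟶ T.X (n : ℤ) :=
  (biprod.snd : P.X (n + 1) ⊞ T.X (n : ℤ) ⟶ T.X (n : ℤ))

/-- The inclusion of the cokernel in degree `0`. -/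
def inr₀ : coker₀ T ⟶ t.cone.X 0 := (biprod.inr : coker₀ T ⟶ P.X 0 ⊞ coker₀ T)

/-- The projection onto the cokernel in degree `0`. -/
def snd₀ : t.cone.X 0 ⟶ coker₀ T := (biprod.snd : P.X 0 ⊞ coker₀ T ⟶ coker₀ T)

lemma inl_fst : ∀ n, t.inl n ≫ t.fst n = 𝟙 _
  | 0 => biprod.inl_fst
  | _ + 1 => biprod.inl_fst

lemma inl_snd (n : ℕ) : t.inl (n + 1) ≫ t.snd n = 0 := biprod.inl_snd
lemma inr_fst (n : ℕ) : t.inr n ≫ t.fst (n + 1) = 0 := biprod.inr_fst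
lemma inr_snd (n : ℕ) : t.inr n ≫ t.snd n = 𝟙 _ := biprod.inr_snd
lemma inl_snd₀ : t.inl 0 ≫ t.snd₀ = 0 := biprod.inl_snd
lemma inr₀_fst : t.inr₀ ≫ t.fst 0 = 0 := biprod.inr_fst
lemma inr₀_snd₀ : t.inr₀ ≫ t.snd₀ = 𝟙 _ := biprod.inr_snd
lemma total (n : ℕ) : t.fst (n + 1) ≫ t.inl (n + 1) + t.snd n ≫ t.inr n = 𝟙 _ := biprod.total
lemma total₀ : t.fst 0 ≫ t.inl 0 + t.snd₀ ≫ t.inr₀ = 𝟙 _ := biprod.total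

lemma cone_d (n : ℕ) : t.cone.d (n + 1) n = t.coneD n := ChainComplex.of_d _ _ _

lemma inl_d : ∀ n : ℕ, t.inl (n + 1) ≫ t.cone.d (n + 1) n = P.d (n + 1) n ≫ t.inl n
  | 0 => (congrArg _ (t.cone_d 0)).trans (biprod.inl_desc _ _)
  | n + 1 => (congrArg _ (t.cone_d (n + 1))).trans (biprod.inl_desc _ _)

lemma inr_d (n : ℕ) : t.inr (n + 1) ≫ t.cone.d (n + 2) (n + 1) =
    t.τ (n + 1) ≫ t.inl (n + 1) + T.d ((n + 1 : ℕ) : ℤ) (n : ℤ) ≫ t.inr n :=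
  (congrArg _ (t.cone_d (n + 1))).trans (biprod.inr_desc _ _)

lemma inr_d₀ : t.inr 0 ≫ t.cone.d 1 0 = t.τ 0 ≫ t.inl 0 + coker₀π T ≫ t.inr₀ :=
  (congrArg _ (t.cone_d 0)).trans (biprod.inr_desc _ _)

lemma d_snd (n : ℕ) : t.cone.d (n + 2) (n + 1) ≫ t.snd n =
    t.snd (n + 1) ≫ T.d ((n + 1 : ℕ) : ℤ) (n : ℤ) := by
  rw [← Category.id_comp (t.cone.d _ _), ← t.total, Preadditive.add_comp, Category.assoc,
    Category.assoc, t.inl_d, t.inr_d]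
  simp [inl_snd, inr_snd]

lemma d_fst (n : ℕ) : t.cone.d (n + 2) (n + 1) ≫ t.fst (n + 1) =
    t.fst (n + 2) ≫ P.d (n + 2) (n + 1) + t.snd (n + 1) ≫ t.τ (n + 1) := by
  rw [← Category.id_comp (t.cone.d _ _), ← t.total, Preadditive.add_comp, Category.assoc,
    Category.assoc, t.inl_d, t.inr_d]
  simp [inl_fst, inr_fst]

lemma d_snd₀ : t.cone.d 1 0 ≫ t.snd₀ = t.snd 0 ≫ coker₀π T := by
  rw [← Category.id_comp (t.cone.d _ _), ← t.total, Preadditive.add_comp, Category.assoc,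
    Category.assoc, t.inl_d, t.inr_d₀]
  simp [inl_snd₀, inr₀_snd₀]

lemma d_fst₀ : t.cone.d 1 0 ≫ t.fst 0 = t.fst 1 ≫ P.d 1 0 + t.snd 0 ≫ t.τ 0 := by
  rw [← Category.id_comp (t.cone.d _ _), ← t.total, Preadditive.add_comp, Category.assoc,
    Category.assoc, t.inl_d, t.inr_d₀]
  simp [inl_fst, inr₀_fst]

/-- The inclusion of `P` in the cone. -/
@[simps]
def coneInl : P ⟶ t.cone where
  f := t.inl
  comm' i j hij := by
    obtain rfl : j + 1 = i := hij
    exact t.inl_d j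

lemma hom_ext {n : ℕ} {Q : Rep.{u} R G} {f g : t.cone.X (n + 1) ⟶ Q}
    (h₁ : t.inl (n + 1) ≫ f = t.inl (n + 1) ≫ g) (h₂ : t.inr n ≫ f = t.inr n ≫ g) : f = g :=
  biprod.hom_ext' _ _ h₁ h₂

end AntiMap

end Cone

section Augmented

variable {M : Rep.{u} R G}

lemma homExact_augmented_iff (C : AugmentedComplex M) (Q : Rep.{u} R G) :
    HomExact Q C.augmented ↔
      (∀ f : Q ⟶ M, ∃ g : Q ⟶ C.cx.X 0, g ≫ C.ε = f) ∧
      (∀ f : Q ⟶ C.cx.X 0, f ≫ C.ε = 0 → ∃ g : Q ⟶ C.cx.X 1, g ≫ C.cx.d 1 0 = f) ∧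
      ∀ (n : ℕ) (f : Q ⟶ C.cx.X (n + 1)), f ≫ C.cx.d (n + 1) n = 0 →
        ∃ g : Q ⟶ C.cx.X (n + 2), g ≫ C.cx.d (n + 2) (n + 1) = f := by
  constructor
  · intro h
    refine ⟨fun f => h (i := 1) (j := 0) rfl f (fun k hk => ?_),
      fun f hf => h (i := 2) (j := 1) rfl f (fun k hk => ?_),
      fun n f hf => h (i := n + 3) (j := n + 2) rfl f (fun k hk => ?_)⟩
    · simp at hk
    · obtain rfl : k = 0 := by simpa using hk
      exact hf
    · obtain rfl : k = n + 1 := by simpa using hk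
      exact hf
  · rintro ⟨h₀, h₁, h₂⟩ i j hij f hf
    obtain rfl : j + 1 = i := hij
    match j, f, hf with
    | 0, f, hf => exact h₀ f
    | 1, f, hf => exact h₁ f (hf 0 rfl)
    | n + 2, f, hf => exact h₂ n f (hf (n + 1) rfl)

end Augmented

/-! ### The cone as a relative resolution -/

namespace AntiMap

variable {M : Rep.{u} R G} {T : ChainComplex (Rep.{u} R G) ℤ} {P : AugmentedComplex M}
  (t : AntiMap T P.cx)

/-- The map induced by the augmentation of `P` on the cokernel of `T_1 ⟶ T_0`. -/
def coker₀Desc : coker₀ T ⟶ M :=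
  cokernel.desc _ (-(t.τ 0 ≫ P.ε)) (by
    rw [Preadditive.comp_neg, ← Category.assoc, ← Preadditive.neg_comp, ← t.comm 0,
      Category.assoc]
    exact (congrArg _ P.d_comp_ε).trans comp_zero)

lemma coker₀π_desc : coker₀π T ≫ t.coker₀Desc = -(t.τ 0 ≫ P.ε) := cokernel.π_desc _ _ _

/-- The augmentation of the cone. -/
def coneε : t.cone.X 0 ⟶ M := t.fst 0 ≫ P.ε + t.snd₀ ≫ t.coker₀Desc

lemma d_coneε : t.cone.d 1 0 ≫ t.coneε = 0 := by
  rw [coneε, Preadditive.comp_add, ← Category.assoc, ← Category.assoc, d_fst₀, d_snd₀,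
    Preadditive.add_comp, Category.assoc, Category.assoc, Category.assoc, coker₀π_desc,
    P.d_comp_ε]
  simp

lemma inl_coneε : t.inl 0 ≫ t.coneε = P.ε := by
  rw [coneε, Preadditive.comp_add, ← Category.assoc, ← Category.assoc, inl_fst, inl_snd₀]
  simp

/-- The cone of `t`, augmented to `M`. -/
def coneAugmented : AugmentedComplex M := ⟨t.cone, t.coneε, t.d_coneε⟩

/-- Acyclicity embeds the cokernel in `T_{-1}` by a map `ι` through which the differential `T_0 ⟶
T_{-1}` factors. A map into the cokernel is thus a cycle in `T_{-1}`, which lifts to `T_0`. -/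
lemma exists_lift_coker₀ {Q : Rep.{u} R G} (hT : T.Acyclic) (hQT : HomExact Q T)
    (b : Q ⟶ coker₀ T) : ∃ b' : Q ⟶ T.X ((0 : ℕ) : ℤ), b' ≫ coker₀π T = b := by
  have hex := hT 0
  rw [HomologicalComplex.exactAt_iff' T (0 + 1) 0 (0 - 1) (by simp) (by simp)] at hex
  have hmono := hex.mono_cokernelDesc
  let ι : coker₀ T ⟶ T.X (0 - 1) := cokernel.desc _ (T.d 0 (0 - 1)) (T.d_comp_d _ _ _)
  have : Mono ι := hmono
  have hι : coker₀π T ≫ ι = T.d 0 (0 - 1) := cokernel.π_desc _ _ _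
  obtain ⟨b', hb'⟩ := hQT (i := 0) (j := 0 - 1) (by simp) (b ≫ ι) (fun k hk => by
    have : ι ≫ T.d (0 - 1) k = 0 := by
      rw [← cancel_epi (coker₀π T), ← Category.assoc, hι, T.d_comp_d, comp_zero]
    rw [Category.assoc, this, comp_zero])
  refine ⟨b', ?_⟩
  rw [← cancel_mono ι, Category.assoc, hι]
  exact hb'

section HomExact

variable {Q : Rep.{u} R G}

/-- Lift the cokernel component to `b : Q ⟶ T_0` and subtract the boundary of `b`. What remains lies
in `P_0` and is killed by the augmentation of `P`, so it lifts to `P_1`. -/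
lemma exists_lift_coneε
    (h : ∀ f : Q ⟶ P.cx.X 0, f ≫ P.ε = 0 → ∃ g : Q ⟶ P.cx.X 1, g ≫ P.cx.d 1 0 = f)
    (hT : T.Acyclic) (hQT : HomExact Q T) (f : Q ⟶ t.cone.X 0) (hf : f ≫ t.coneε = 0) :
    ∃ g : Q ⟶ t.cone.X 1, g ≫ t.cone.d 1 0 = f := by
  obtain ⟨b, hb⟩ := exists_lift_coker₀ hT hQT (f ≫ t.snd₀)
  obtain ⟨a, ha⟩ := h (f ≫ t.fst 0 - b ≫ t.τ 0) (by
    rw [← hf, coneε, Preadditive.comp_add, ← Category.assoc f t.snd₀, ← hb, Category.assoc b,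
      coker₀π_desc]
    simp [sub_eq_add_neg])
  refine ⟨a ≫ t.inl 1 + b ≫ t.inr 0, ?_⟩
  have hf' : f = (f ≫ t.fst 0) ≫ t.inl 0 + (f ≫ t.snd₀) ≫ t.inr₀ := by
    rw [Category.assoc, Category.assoc, ← Preadditive.comp_add, total₀, Category.comp_id]
  rw [Preadditive.add_comp, Category.assoc, Category.assoc, inl_d, inr_d₀,
    ← Category.assoc a, ha, Preadditive.comp_add, ← Category.assoc b (coker₀π T), hb,
    ← Category.assoc b, Preadditive.sub_comp]
  conv_rhs => rw [hf']
  abel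

lemma exists_lift_cone (n : ℕ) (h : ∀ f : Q ⟶ P.cx.X (n + 1), f ≫ P.cx.d (n + 1) n = 0 →
      ∃ g : Q ⟶ P.cx.X (n + 2), g ≫ P.cx.d (n + 2) (n + 1) = f)
    (hQT : HomExact Q T) (f : Q ⟶ t.cone.X (n + 1)) (hf : f ≫ t.cone.d (n + 1) n = 0) :
    ∃ g : Q ⟶ t.cone.X (n + 2), g ≫ t.cone.d (n + 2) (n + 1) = f := by
  have h₁ : f ≫ t.fst (n + 1) ≫ P.cx.d (n + 1) n + f ≫ t.snd n ≫ t.τ n = 0 := by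
    rw [← Preadditive.comp_add]
    cases n with
    | zero => rw [← d_fst₀, ← Category.assoc, hf, zero_comp]
    | succ n => rw [← d_fst, ← Category.assoc, hf, zero_comp]
  -- The component in `T_n` is a cycle. For `n = 0` the cone only says that it dies in the cokernel,
  -- but `T_0 ⟶ T_{-1}` factors through that cokernel.
  have h₂ : ∀ k : ℤ, (ComplexShape.down ℤ).Rel n k → (f ≫ t.snd n) ≫ T.d (n : ℤ) k = 0 := by
    intro k hk
    cases n with
    | zero =>
      have h₂ : f ≫ t.snd 0 ≫ coker₀π T = 0 := by
        rw [← d_snd₀, ← Category.assoc, hf, zero_comp]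
      have : coker₀π T ≫ cokernel.desc _ (T.d ((0 : ℕ) : ℤ) k) (T.d_comp_d _ _ _) =
        T.d ((0 : ℕ) : ℤ) k := cokernel.π_desc _ _ _
      rw [← this, ← Category.assoc, Category.assoc f, h₂, zero_comp]
    | succ n =>
      obtain rfl : k = n := by simpa using hk
      rw [Category.assoc, ← d_snd, ← Category.assoc, hf, zero_comp]
  obtain ⟨b, hb⟩ := hQT (i := ((n + 1 : ℕ) : ℤ)) (j := (n : ℤ)) (by simp) (f ≫ t.snd n) h₂
  obtain ⟨a, ha⟩ := h (f ≫ t.fst (n + 1) - b ≫ t.τ (n + 1)) (by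
    rw [← h₁, Preadditive.sub_comp, Category.assoc b, t.comm, ← Category.assoc f (t.snd n), ← hb]
    simp)
  refine ⟨a ≫ t.inl (n + 2) + b ≫ t.inr (n + 1), ?_⟩
  have hf' : f = (f ≫ t.fst (n + 1)) ≫ t.inl (n + 1) + (f ≫ t.snd n) ≫ t.inr n := by
    rw [Category.assoc, Category.assoc, ← Preadditive.comp_add, total, Category.comp_id]
  rw [Preadditive.add_comp, Category.assoc, Category.assoc, inl_d, inr_d,
    ← Category.assoc a, ha, Preadditive.comp_add, ← Category.assoc b (T.d _ _), hb,
    ← Category.assoc b, Preadditive.sub_comp]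
  conv_rhs => rw [hf']
  abel

/-- The cone of a map from an acyclic complex to a resolution is a resolution, relatively to
`Q`. -/
theorem homExact_cone (hT : T.Acyclic) (hQT : HomExact Q T) (hQP : HomExact Q P.augmented) :
    HomExact Q t.coneAugmented.augmented := by
  rw [homExact_augmented_iff] at hQP ⊢
  obtain ⟨h₀, h₁, h₂⟩ := hQP
  refine ⟨fun f => ?_, t.exists_lift_coneε h₁ hT hQT, fun n => t.exists_lift_cone n (h₂ n) hQT⟩
  obtain ⟨g, hg⟩ := h₀ f
  refine ⟨g ≫ t.inl 0, (Category.assoc _ _ _).trans ?_⟩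
  exact (congrArg _ t.inl_coneε).trans hg

end HomExact

end AntiMap

/-! ### Properness -/

section Proper

variable (S : ChainComplex (Rep.{u} R G) ℤ) (X : ChainComplex (Rep.{u} R G) ℕ)

/-- The complex of maps from `S` to the cycles of `X` in degree `j + 1` is exact. -/
def CyclesExact (j : ℕ) : Prop :=
  ∀ ⦃k i l : ℤ⦄, (ComplexShape.down ℤ).Rel k i → (ComplexShape.down ℤ).Rel i l →
    ∀ f : S.X i ⟶ X.X (j + 1), S.d k i ≫ f = 0 → f ≫ X.d (j + 1) j = 0 →
      ∃ g : S.X l ⟶ X.X (j + 1), S.d i l ≫ g = f ∧ g ≫ X.d (j + 1) j = 0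

variable {S X}

/-- With `Z` denoting cycles, `0 ⟶ Z_{j+2} ⟶ X_{j+2} ⟶ Z_{j+1} ⟶ 0` stays exact under `Hom(S_i, -)`,
since the `S_i` are `𝔉`-projective. `Hom(S, -)` is exact on the first two terms, hence on the third;
the proof is this diagram chase. -/
lemma CyclesExact.of_succ (hS : IsTotallyFAcyclic S)
    (hX : ∀ Q : Rep.{u} R G, IsFProjective Q → HomExact Q X) {j : ℕ}
    (hj : IsFProjective (X.X (j + 2))) (h : CyclesExact S X (j + 1)) : CyclesExact S X j := by
  intro k i l hk hl f hf hfd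
  obtain ⟨u, hu⟩ := hX _ (hS.projective i) (i := j + 2) (j := j + 1) rfl f (fun m hm => by
    obtain rfl : m = j := by simpa using hm
    exact hfd)
  obtain ⟨v, hv, hvd⟩ := h (k := k + 1) (i := k) (l := i) rfl hk (S.d k i ≫ u)
    (by rw [← Category.assoc, S.d_comp_d, zero_comp]) (by rw [Category.assoc, hu, hf])
  obtain ⟨w, hw⟩ := hS.coHomExact _ hj hk hl (u - v) (by
    rw [Preadditive.comp_sub, hv, sub_self])
  refine ⟨w ≫ X.d (j + 2) (j + 1), ?_, ?_⟩
  · rw [← Category.assoc, hw, Preadditive.sub_comp, hvd, hu, sub_zero]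
  · rw [Category.assoc, X.d_comp_d, comp_zero]

/-- Pulled back to `S_m`, the map lifts to some `u`, which need not vanish on the image of
`S_{m+1}`. The defect is a cocycle with values in cycles, so it extends to a map `v` from `S_m` into
cycles, and `u - v` descends to the cokernel. -/
lemma homExact_cokernel_of_cyclesExact (hS : IsTotallyFAcyclic S)
    (hX : ∀ Q : Rep.{u} R G, IsFProjective Q → HomExact Q X)
    (h : ∀ j, CyclesExact S X j) (m : ℤ) : HomExact (cokernel (S.d (m + 1) m)) X := by
  intro i j hij f hf
  obtain rfl : j + 1 = i := hij
  let π := cokernel.π (S.d (m + 1) m)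
  have hπ : S.d (m + 1) m ≫ π = 0 := cokernel.condition _
  obtain ⟨u, hu⟩ := hX _ (hS.projective m) (i := j + 1) (j := j) rfl (π ≫ f) (fun k hk => by
    rw [Category.assoc, hf k hk, comp_zero])
  obtain ⟨v, hv, hvd⟩ := h j (k := m + 1 + 1) (i := m + 1) (l := m) rfl rfl
    (S.d (m + 1) m ≫ u) (by rw [← Category.assoc, S.d_comp_d, zero_comp])
    (by rw [Category.assoc, hu, ← Category.assoc, hπ, zero_comp])
  refine ⟨cokernel.desc _ (u - v) (by rw [Preadditive.comp_sub, hv, sub_self]), ?_⟩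
  rw [← cancel_epi π, ← Category.assoc, cokernel.π_desc, Preadditive.sub_comp, hvd, hu, sub_zero]

/-- A resolution whose terms are `𝔉`-projective above the lowest one and whose cycles in high
degrees are orthogonal to totally `𝔉`-acyclic complexes is `𝔉_G`-proper. -/
theorem isFGProper_of_cyclesExact (hX : ∀ Q : Rep.{u} R G, IsFProjective Q → HomExact Q X)
    (hXp : ∀ j, IsFProjective (X.X (j + 2))) (N : ℕ)
    (hN : ∀ S : ChainComplex (Rep.{u} R G) ℤ, IsTotallyFAcyclic S → ∀ j, N ≤ j →
      CyclesExact S X j) : IsFGProper X := by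
  rw [isFGProper_iff]
  rintro Q ⟨M, T, m, hT, ⟨e⟩⟩
  have hS := hT.isTotallyFAcyclic
  have h : ∀ d j, N ≤ j + d → CyclesExact T.cx X j := by
    intro d
    induction d with
    | zero => exact fun j hj => hN _ hS j hj
    | succ d ih => exact fun j hj => (ih (j + 1) (by omega)).of_succ hS hX (hXp j)
  exact HomExact.of_retract e.retract
    (homExact_cokernel_of_cyclesExact hS hX (fun j => h N j (by omega)) m)

end Proper

/-- A cycle `(a, b)` in cone degree `n + 2` satisfies `b = -τ⁻¹ (d a)`, and injectivity of `τ n`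
makes `d b = 0` automatic. The cycles are therefore a copy of the `𝔉`-projective `P_{n+2}`. The
augmentation shifts indices by one: cycles of the augmented complex in degree `n + 3` are meant. -/
lemma AntiMap.cyclesExact {M : Rep.{u} R G} {T S : ChainComplex (Rep.{u} R G) ℤ}
    {P : AugmentedComplex M} (t : AntiMap T P.cx) (hS : IsTotallyFAcyclic S) (n : ℕ)
    (hP : IsFProjective (P.cx.X (n + 2))) [IsIso (t.τ (n + 1))] [Mono (t.τ n)] :
    CyclesExact S t.coneAugmented.augmented (n + 2) := by
  have key : ∀ ⦃k i l : ℤ⦄, (ComplexShape.down ℤ).Rel k i → (ComplexShape.down ℤ).Rel i l →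
      ∀ f : S.X i ⟶ t.cone.X (n + 2), S.d k i ≫ f = 0 → f ≫ t.cone.d (n + 2) (n + 1) = 0 →
        ∃ g : S.X l ⟶ t.cone.X (n + 2), S.d i l ≫ g = f ∧ g ≫ t.cone.d (n + 2) (n + 1) = 0 := by
    intro k i l hk hl f hf hfd
    have h₁ : f ≫ t.fst (n + 2) ≫ P.cx.d (n + 2) (n + 1) + f ≫ t.snd (n + 1) ≫ t.τ (n + 1) = 0 := by
      rw [← Preadditive.comp_add, ← d_fst, ← Category.assoc, hfd, zero_comp]
    obtain ⟨a, ha⟩ := hS.coHomExact _ hP hk hl (f ≫ t.fst (n + 2)) (by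
      rw [← Category.assoc, hf, zero_comp])
    let b : S.X l ⟶ T.X ((n + 1 : ℕ) : ℤ) :=
      -(a ≫ P.cx.d (n + 2) (n + 1) ≫ inv (t.τ (n + 1)))
    have hbτ : b ≫ t.τ (n + 1) = -(a ≫ P.cx.d (n + 2) (n + 1)) := by simp [b]
    have hb : S.d i l ≫ b = f ≫ t.snd (n + 1) := by
      rw [← cancel_mono (t.τ (n + 1)), Category.assoc, hbτ, Preadditive.comp_neg,
        ← Category.assoc, ha, neg_eq_iff_add_eq_zero, Category.assoc, Category.assoc, h₁]
    refine ⟨a ≫ t.inl (n + 2) + b ≫ t.inr (n + 1), ?_, ?_⟩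
    · rw [Preadditive.comp_add, ← Category.assoc, ← Category.assoc, ha, hb, Category.assoc,
        Category.assoc, ← Preadditive.comp_add, total, Category.comp_id]
    · have hbd : b ≫ T.d ((n + 1 : ℕ) : ℤ) (n : ℤ) = 0 := by
        rw [← cancel_mono (t.τ n), Category.assoc, ← neg_eq_iff_eq_neg.2 (t.comm n),
          Preadditive.comp_neg, ← Category.assoc, hbτ]
        simp
      rw [Preadditive.add_comp, Category.assoc, Category.assoc, inl_d, inr_d,
        Preadditive.comp_add, ← Category.assoc b, ← Category.assoc b, hbτ, hbd]
      simp
  exact key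

/-! ### The long exact sequence of the cone -/

namespace AntiMap

variable {T : ChainComplex (Rep.{u} R G) ℤ} {P : ChainComplex (Rep.{u} R G) ℕ}
  (t : AntiMap T P) {M : Rep.{u} R G}

/-- The projection of the cone onto the shift of `T`, in cohomology. -/
def coneδ : ∀ n : ℕ, cohomology T (n : ℤ) ⟶ cohomology (toInt t.cone) ((n + 1 : ℕ) : ℤ)
  -- The cone ends in the cokernel where `T` continues with `T_{-1}`; the map induced by the
  -- differential of `T` bridges the two.
  | 0 => cohomologyShiftMap (m₂ := ((2 : ℕ) : ℤ)) (m₀ := ((0 : ℕ) : ℤ))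
      (n₂ := ((1 : ℕ) : ℤ)) (n₀ := -1) rfl rfl rfl (by simp)
      ((toIntXIso t.cone 2).hom ≫ t.snd 1)
      ((toIntXIso t.cone 1).hom ≫ t.snd 0)
      ((toIntXIso t.cone 0).hom ≫ t.snd₀ ≫
        cokernel.desc _ (T.d ((0 : ℕ) : ℤ) (-1)) (T.d_comp_d _ _ _))
      (by rw [Category.assoc, ← d_snd, ← Category.assoc, ← toInt_d, Category.assoc])
      (by rw [← Category.assoc ((toInt _).d _ _), toInt_d, Category.assoc, Category.assoc,
            ← Category.assoc (t.cone.d 1 0), d_snd₀, Category.assoc, cokernel.π_desc])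
  | n + 1 => cohomologyShiftMap (m₂ := ((n + 3 : ℕ) : ℤ)) (m₀ := ((n + 1 : ℕ) : ℤ))
      (n₂ := ((n + 2 : ℕ) : ℤ)) (n₀ := (n : ℤ)) 
      (by simp only [ComplexShape.down_Rel]; omega)
      (by simp only [ComplexShape.down_Rel]; omega)
      (by simp only [ComplexShape.down_Rel]; omega)
      (by simp only [ComplexShape.down_Rel]; omega)
      ((toIntXIso t.cone (n + 3)).hom ≫ t.snd (n + 2))
      ((toIntXIso t.cone (n + 2)).hom ≫ t.snd (n + 1))
      ((toIntXIso t.cone (n + 1)).hom ≫ t.snd n)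
      (by rw [Category.assoc, ← d_snd, ← Category.assoc, ← toInt_d, Category.assoc])
      (by rw [Category.assoc, ← d_snd, ← Category.assoc, ← toInt_d, Category.assoc])

lemma represents_coneδ {n : ℕ} {x : (cohomology T ((n + 1 : ℕ) : ℤ)).obj M}
    {f : T.X ((n + 1 : ℕ) : ℤ) ⟶ M} (h : Represents x f) :
    NatRepresents ((t.coneδ (n + 1)).app M x) (t.snd (n + 1) ≫ f) := by
  rw [NatRepresents, ← Category.assoc]
  exact Represents.shiftMap (m₂ := ((n + 3 : ℕ) : ℤ)) (m₀ := ((n + 1 : ℕ) : ℤ))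
    (n₂ := ((n + 2 : ℕ) : ℤ)) (n₀ := (n : ℤ)) (by simp only [ComplexShape.down_Rel]; omega)
    (by simp only [ComplexShape.down_Rel]; omega)
    (by simp only [ComplexShape.down_Rel]; omega)
    (by simp only [ComplexShape.down_Rel]; omega) _ _ _ _ _ h

/-- If the restriction of `f` to `P_1` is the coboundary of `a`, then `f` minus the coboundary of
`a` lives on `T_0` and vanishes on the image of `T_1`. It therefore factors through the cokernel
sitting in degree `0`, which makes it a coboundary. -/
lemma injective_coneInl_one :
    Function.Injective ((cohomologyMap (toIntMap t.coneInl) ((1 : ℕ) : ℤ)).app M) := by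
  rw [injective_iff_map_eq_zero]
  intro x hx
  obtain ⟨f, hf⟩ := NatRepresents.exists_rep x
  obtain ⟨a, ha⟩ := ((hf.map t.coneInl).eq_zero_iff (n := 0)).1 hx
  have hfc : t.cone.d 2 1 ≫ f = 0 := hf.cocycle
  have ha : P.d 1 0 ≫ a = t.inl 1 ≫ f := ha
  have h₂ : t.τ 1 ≫ t.inl 1 ≫ f + T.d ((1 : ℕ) : ℤ) ((0 : ℕ) : ℤ) ≫ t.inr 0 ≫ f = 0 := by
    rw [← Category.assoc, ← Category.assoc, ← Preadditive.add_comp, ← t.inr_d, Category.assoc,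
      hfc, comp_zero]
  let b : coker₀ T ⟶ M := cokernel.desc _ (t.inr 0 ≫ f - t.τ 0 ≫ a) (by
    rw [← h₂, Preadditive.comp_sub, ← Category.assoc _ _ a, ← ha, ← Category.assoc _ _ a,
      t.comm 0]
    simp [sub_eq_add_neg, add_comm])
  have hb : coker₀π T ≫ b = t.inr 0 ≫ f - t.τ 0 ≫ a := cokernel.π_desc _ _ _
  refine (hf.eq_zero_iff (n := 0)).2 ⟨t.fst 0 ≫ a + t.snd₀ ≫ b, ?_⟩
  rw [Preadditive.comp_add, ← Category.assoc, ← Category.assoc, d_fst₀, d_snd₀]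
  apply t.hom_ext
  · simp only [Preadditive.comp_add, Preadditive.add_comp, ← Category.assoc, inl_fst, inl_snd]
    simp [ha]
  · simp only [Preadditive.comp_add, Preadditive.add_comp, ← Category.assoc, inr_fst, inr_snd]
    simp only [zero_comp, Category.id_comp, zero_add, hb, add_sub_cancel]

variable {θ : ∀ n : ℕ, T.X (n : ℤ) ⟶ P.X n} {e : ℕ → ℤ} {Θ : T ⟶ toInt P}

lemma represents_map (hΘ : ∀ n : ℕ, Θ.f (n : ℤ) ≫ (toIntXIso P n).hom = θ n) {n : ℕ}
    {x : (cohomology (toInt P) (n : ℤ)).obj M} {f : P.X n ⟶ M} (h : NatRepresents x f) :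
    Represents ((cohomologyMap Θ (n : ℤ)).app M x) (θ n ≫ f) := by
  rw [← hΘ, Category.assoc]
  exact Represents.map Θ h

/-- A cocycle `a` on `P` extends to the cone exactly when its pullback to `T` bounds; a bounding
cochain `s` supplies the component on `T`. The factors `e` are the signs between `θ` and `τ`, which
the two hypotheses let one pass in either direction. -/
lemma exact_coneInl_map (hΘ : ∀ n : ℕ, Θ.f (n : ℤ) ≫ (toIntXIso P n).hom = θ n)
    (hθ : ∀ n, θ n = e n • t.τ n) (hτ : ∀ n, t.τ n = e n • θ n) (n : ℕ) :
    Function.Exact ((cohomologyMap (toIntMap t.coneInl) ((n + 1 : ℕ) : ℤ)).app M)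
      ((cohomologyMap Θ ((n + 1 : ℕ) : ℤ)).app M) := by
  intro x
  constructor
  · intro hx
    obtain ⟨a, ha⟩ := NatRepresents.exists_rep x
    obtain ⟨s, hs⟩ := ((represents_map hΘ ha).eq_zero_iff (j := (n : ℤ)) (by simp)).1 hx
    have hac := ha.cocycle
    have hfc : t.cone.d (n + 2) (n + 1) ≫ (t.fst (n + 1) ≫ a - t.snd n ≫ (e (n + 1) • s)) = 0 := by
      rw [Preadditive.comp_sub, ← Category.assoc, ← Category.assoc, d_fst, d_snd,
        Preadditive.add_comp, Category.assoc, hac, Category.assoc, Category.assoc,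
        Preadditive.comp_zsmul, hs, hτ]
      simp
    obtain ⟨y, hy⟩ := NatRepresents.exists_class hfc
    refine ⟨y, (hy.map t.coneInl).eq_of_sub ha 0 ?_⟩
    rw [coneInl_f, Preadditive.comp_sub, ← Category.assoc, ← Category.assoc, inl_fst, inl_snd]
    simp
  · rintro ⟨y, rfl⟩
    obtain ⟨f, hf⟩ := NatRepresents.exists_rep y
    refine ((represents_map hΘ (hf.map t.coneInl)).eq_zero_iff (j := (n : ℤ)) (by simp)).2
      ⟨-(e (n + 1) • t.inr n ≫ f), ?_⟩
    have h₂ : t.τ (n + 1) ≫ t.inl (n + 1) ≫ f +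
        T.d ((n + 1 : ℕ) : ℤ) (n : ℤ) ≫ t.inr n ≫ f = 0 := by
      rw [← Category.assoc, ← Category.assoc, ← Preadditive.add_comp, ← t.inr_d, Category.assoc,
        hf.cocycle, comp_zero]
    rw [Preadditive.comp_neg, Preadditive.comp_zsmul, eq_neg_of_add_eq_zero_right h₂, hθ,
      coneInl_f]
    simp

/-- A cochain `g` on the cone bounding the class of `b` restricts to a cocycle on `P`. Its
restriction to `T` exhibits `b` as cohomologous to the pullback of that cocycle, up to sign. -/
lemma exact_map_coneδ (hΘ : ∀ n : ℕ, Θ.f (n : ℤ) ≫ (toIntXIso P n).hom = θ n)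
    (hθ : ∀ n, θ n = e n • t.τ n) (hτ : ∀ n, t.τ n = e n • θ n) (n : ℕ) :
    Function.Exact ((cohomologyMap Θ ((n + 1 : ℕ) : ℤ)).app M) ((t.coneδ (n + 1)).app M) := by
  intro x
  constructor
  · intro hx
    obtain ⟨b, hb⟩ := Represents.exists_rep x
    obtain ⟨g, hg⟩ := (t.represents_coneδ hb).eq_zero_iff.1 hx
    have h₁ : P.d (n + 2) (n + 1) ≫ (e (n + 1) • t.inl (n + 1) ≫ g) = 0 := by
      rw [Preadditive.comp_zsmul, ← Category.assoc, ← inl_d, Category.assoc, hg,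
        ← Category.assoc, inl_snd]
      simp
    have h₂ : t.τ (n + 1) ≫ t.inl (n + 1) ≫ g +
        T.d ((n + 1 : ℕ) : ℤ) (n : ℤ) ≫ t.inr n ≫ g = b := by
      rw [← Category.assoc, ← Category.assoc, ← Preadditive.add_comp, ← t.inr_d, Category.assoc,
        hg, ← Category.assoc, inr_snd, Category.id_comp]
    obtain ⟨y, hy⟩ := NatRepresents.exists_class h₁
    refine ⟨y, (represents_map hΘ hy).eq_of_sub hb (j := (n : ℤ)) (by simp)
      (-(t.inr n ≫ g)) ?_⟩
    rw [← h₂, Preadditive.comp_zsmul, ← Preadditive.zsmul_comp, ← hτ]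
    simp
  · rintro ⟨y, rfl⟩
    obtain ⟨a, ha⟩ := NatRepresents.exists_rep y
    refine (t.represents_coneδ (represents_map hΘ ha)).eq_zero_iff.2
      ⟨t.fst (n + 1) ≫ (e (n + 1) • a), ?_⟩
    rw [← Category.assoc, d_fst, Preadditive.add_comp, Category.assoc, Preadditive.comp_zsmul,
      ha.cocycle, hθ]
    simp

/-- If the restriction of `f` to `P` is the coboundary of `a`, subtracting the coboundary of `a`
extended by zero leaves a cocycle supported on `T`. -/
lemma exact_coneδ_coneInl (n : ℕ) :
    Function.Exact ((t.coneδ (n + 1)).app M)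
      ((cohomologyMap (toIntMap t.coneInl) ((n + 2 : ℕ) : ℤ)).app M) := by
  intro x
  constructor
  · intro hx
    obtain ⟨f, hf⟩ := NatRepresents.exists_rep x
    obtain ⟨a, ha⟩ := ((hf.map t.coneInl).eq_zero_iff (n := n + 1)).1 hx
    have ha : P.d (n + 2) (n + 1) ≫ a = t.inl (n + 2) ≫ f := ha
    have h₂ : t.τ (n + 2) ≫ t.inl (n + 2) ≫ f +
        T.d ((n + 2 : ℕ) : ℤ) ((n + 1 : ℕ) : ℤ) ≫ t.inr (n + 1) ≫ f = 0 := by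
      rw [← Category.assoc, ← Category.assoc, ← Preadditive.add_comp, ← t.inr_d, Category.assoc,
        hf.cocycle, comp_zero]
    obtain ⟨y, hy⟩ := Represents.exists_class (C := T) (i := ((n + 1 : ℕ) : ℤ))
      (f := t.inr (n + 1) ≫ f - t.τ (n + 1) ≫ a) (fun k hk => by
        obtain rfl : ((n + 2 : ℕ) : ℤ) = k := by
          rw [← show ((n + 1 : ℕ) : ℤ) + 1 = k from hk]
          push_cast
          ring
        rw [← h₂, Preadditive.comp_sub, ← Category.assoc _ _ a, ← ha, ← Category.assoc _ _ a,
          t.comm (n + 1)]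
        simp only [Preadditive.neg_comp, Category.assoc, sub_eq_add_neg, add_comm])
    refine ⟨y, (t.represents_coneδ hy).eq_of_sub hf (-(t.fst (n + 1) ≫ a)) ?_⟩
    rw [Preadditive.comp_neg, ← Category.assoc, d_fst]
    apply t.hom_ext
    · simp only [Preadditive.comp_add, Preadditive.comp_neg, Preadditive.comp_sub,
        Preadditive.add_comp, ← Category.assoc, inl_fst, inl_snd]
      simp [ha]
    · simp only [Preadditive.comp_add, Preadditive.comp_neg, Preadditive.comp_sub,
        Preadditive.add_comp, ← Category.assoc, inr_fst, inr_snd]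
      simp
  · rintro ⟨y, rfl⟩
    obtain ⟨b, hb⟩ := Represents.exists_rep y
    refine (((t.represents_coneδ hb).map t.coneInl).eq_zero_iff (n := n + 1)).2 ⟨0, ?_⟩
    rw [coneInl_f, ← Category.assoc, inl_snd]
    simp

end AntiMap

/-! ### Comparison of relative resolutions -/

section Comparison

variable {M : Rep.{u} R G}

namespace AugmentedComplex

variable {C D E : AugmentedComplex M}

/-- This is the usual degreewise comparison. Exactness of `D` is used only under `Hom` from the
terms of `C`, so the lemma serves both `𝔉`-split and `𝔉_G`-proper resolutions. -/
lemma exists_liftsId (h : ∀ n, HomExact (C.cx.X n) D.augmented) :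
    ∃ f : C.cx ⟶ D.cx, LiftsId C D f := by
  have h' := fun n => (homExact_augmented_iff D _).1 (h n)
  obtain ⟨f₀, hf₀⟩ := (h' 0).1 C.ε
  obtain ⟨f₁, hf₁⟩ := (h' 1).2.1 (C.cx.d 1 0 ≫ f₀) (by
    rw [Category.assoc, hf₀, C.d_comp_ε])
  have hs : ∀ (n : ℕ) (p : Σ' (f : C.cx.X n ⟶ D.cx.X n) (f' : C.cx.X (n + 1) ⟶ D.cx.X (n + 1)),
      f' ≫ D.cx.d (n + 1) n = C.cx.d (n + 1) n ≫ f), ∃ f'' : C.cx.X (n + 2) ⟶ D.cx.X (n + 2),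
        f'' ≫ D.cx.d (n + 2) (n + 1) = C.cx.d (n + 2) (n + 1) ≫ p.2.1 := fun n p =>
    (h' (n + 2)).2.2 n _ (by
      rw [Category.assoc, p.2.2, ← Category.assoc, C.cx.d_comp_d, zero_comp])
  exact ⟨ChainComplex.mkHom _ _ f₀ f₁ hf₁
    (fun n p => ⟨(hs n p).choose, (hs n p).choose_spec⟩), hf₀⟩

lemma exists_homotopy (h : ∀ n, HomExact (C.cx.X n) D.augmented) (φ : C.cx ⟶ D.cx)
    (hφ : φ.f 0 ≫ D.ε = 0) : Nonempty (Homotopy φ 0) := by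
  have h' := fun n => (homExact_augmented_iff D _).1 (h n)
  obtain ⟨s₀, hs₀⟩ := (h' 0).2.1 (φ.f 0) hφ
  obtain ⟨s₁, hs₁⟩ := (h' 1).2.2 0 (φ.f 1 - C.cx.d 1 0 ≫ s₀) (by
    rw [Preadditive.sub_comp, Category.assoc, hs₀, φ.comm, sub_self])
  have hs : ∀ (n : ℕ) (p : Σ' (f : C.cx.X n ⟶ D.cx.X (n + 1))
      (f' : C.cx.X (n + 1) ⟶ D.cx.X (n + 2)),
      φ.f (n + 1) = C.cx.d (n + 1) n ≫ f + f' ≫ D.cx.d (n + 2) (n + 1)),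
      ∃ f'' : C.cx.X (n + 2) ⟶ D.cx.X (n + 3),
        φ.f (n + 2) = C.cx.d (n + 2) (n + 1) ≫ p.2.1 + f'' ≫ D.cx.d (n + 3) (n + 2) := by
    intro n p
    obtain ⟨g, hg⟩ := (h' (n + 2)).2.2 (n + 1) (φ.f (n + 2) - C.cx.d (n + 2) (n + 1) ≫ p.2.1) (by
      rw [Preadditive.sub_comp, Category.assoc, ← sub_eq_of_eq_add' p.2.2, φ.comm,
        Preadditive.comp_sub, ← Category.assoc _ _ p.1, C.cx.d_comp_d, zero_comp, sub_zero,
        sub_self])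
    exact ⟨g, by rw [hg, add_sub_cancel]⟩
  exact ⟨Homotopy.mkInductive φ s₀ hs₀.symm s₁ (by rw [hs₁, add_sub_cancel])
    (fun n p => ⟨(hs n p).choose, (hs n p).choose_spec⟩)⟩

/-- Chain maps lifting the identity induce the same map in positive degrees. -/
lemma cohomologyMap_eq (h : ∀ n, HomExact (C.cx.X n) D.augmented) {φ ψ : C.cx ⟶ D.cx}
    (hφ : LiftsId C D φ) (hψ : LiftsId C D ψ) (n : ℕ) (A : Rep.{u} R G)
    (x : (cohomology (toInt D.cx) ((n + 1 : ℕ) : ℤ)).obj A) :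
    (cohomologyMap (toIntMap φ) ((n + 1 : ℕ) : ℤ)).app A x =
      (cohomologyMap (toIntMap ψ) ((n + 1 : ℕ) : ℤ)).app A x := by
  obtain ⟨f, hf⟩ := NatRepresents.exists_rep x
  obtain ⟨s⟩ := exists_homotopy h (φ - ψ) (by
    rw [HomologicalComplex.sub_f_apply, Preadditive.sub_comp, hφ, hψ, sub_self])
  refine (hf.map φ).eq_of_sub (hf.map ψ) (s.hom n (n + 1) ≫ f) ?_
  have hs := s.comm (n + 1)
  rw [Homotopy.prevD_chainComplex, Homotopy.dNext_succ_chainComplex,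
    HomologicalComplex.zero_f, add_zero, HomologicalComplex.sub_f_apply] at hs
  rw [← Preadditive.sub_comp, hs, Preadditive.add_comp, Category.assoc, Category.assoc,
    hf.cocycle, comp_zero, add_zero]

lemma LiftsId.comp {φ : C.cx ⟶ D.cx} {ψ : D.cx ⟶ E.cx} (hφ : LiftsId C D φ)
    (hψ : LiftsId D E ψ) : LiftsId C E (φ ≫ ψ) := by
  rw [LiftsId, HomologicalComplex.comp_f, Category.assoc, hψ, hφ]

end AugmentedComplex

lemma cohomologyMap_comp_apply {C D E : ChainComplex (Rep.{u} R G) ℕ} (φ : C ⟶ D) (ψ : D ⟶ E)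
    (n : ℕ) (A : Rep.{u} R G) (x : (cohomology (toInt E) ((n + 1 : ℕ) : ℤ)).obj A) :
    (cohomologyMap (toIntMap (φ ≫ ψ)) ((n + 1 : ℕ) : ℤ)).app A x =
      (cohomologyMap (toIntMap φ) ((n + 1 : ℕ) : ℤ)).app A
        ((cohomologyMap (toIntMap ψ) ((n + 1 : ℕ) : ℤ)).app A x) := by
  obtain ⟨f, hf⟩ := NatRepresents.exists_rep x
  refine (hf.map (φ ≫ ψ)).eq_of_sub ((hf.map ψ).map φ) 0 ?_
  simp

lemma cohomologyMap_id_apply {C : ChainComplex (Rep.{u} R G) ℕ} (n : ℕ) (A : Rep.{u} R G)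
    (x : (cohomology (toInt C) ((n + 1 : ℕ) : ℤ)).obj A) :
    (cohomologyMap (toIntMap (𝟙 C)) ((n + 1 : ℕ) : ℤ)).app A x = x := by
  obtain ⟨f, hf⟩ := NatRepresents.exists_rep x
  refine (hf.map (𝟙 C)).eq_of_sub hf 0 ?_
  simp

lemma cohomologyMap_toIntMap_apply {T : ChainComplex (Rep.{u} R G) ℤ}
    {C D : ChainComplex (Rep.{u} R G) ℕ} {θ : ∀ n : ℕ, T.X (n : ℤ) ⟶ C.X n} {Θ : T ⟶ toInt C}
    {Θ' : T ⟶ toInt D} (φ : C ⟶ D)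
    (hΘ : ∀ n : ℕ, Θ.f (n : ℤ) ≫ (toIntXIso C n).hom = θ n)
    (hΘ' : ∀ n : ℕ, Θ'.f (n : ℤ) ≫ (toIntXIso D n).hom = θ n ≫ φ.f n) (n : ℕ) (A : Rep.{u} R G)
    (x : (cohomology (toInt D) ((n + 1 : ℕ) : ℤ)).obj A) :
    (cohomologyMap Θ' ((n + 1 : ℕ) : ℤ)).app A x =
      (cohomologyMap Θ ((n + 1 : ℕ) : ℤ)).app A
        ((cohomologyMap (toIntMap φ) ((n + 1 : ℕ) : ℤ)).app A x) := by
  obtain ⟨f, hf⟩ := NatRepresents.exists_rep x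
  refine (AntiMap.represents_map hΘ' hf).eq_of_sub (AntiMap.represents_map hΘ (hf.map φ))
    (j := (n : ℤ)) (by simp) 0 ?_
  simp

/-- Mutually inverse comparison maps between relative resolutions induce mutually inverse maps in
positive degrees. -/
lemma AugmentedComplex.cohomologyMap_leftInverse {C D : AugmentedComplex M}
    (h : ∀ n, HomExact (C.cx.X n) C.augmented) {φ : C.cx ⟶ D.cx} {ψ : D.cx ⟶ C.cx}
    (hφ : LiftsId C D φ) (hψ : LiftsId D C ψ) (n : ℕ) (A : Rep.{u} R G) :
    Function.LeftInverse ((cohomologyMap (toIntMap φ) ((n + 1 : ℕ) : ℤ)).app A)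
      ((cohomologyMap (toIntMap ψ) ((n + 1 : ℕ) : ℤ)).app A) := by
  intro x
  rw [← cohomologyMap_comp_apply, cohomologyMap_eq h (hφ.comp hψ) (ψ := 𝟙 _)
    (Category.id_comp _), cohomologyMap_id_apply]

lemma FResolution.homExact (P : FResolution M) {Q : Rep.{u} R G} (hQ : IsFProjective Q) :
    HomExact Q P.toAugmentedComplex.augmented :=
  P.split.homExact hQ

lemma FGResolution.homExact (L : FGResolution M) {Q : Rep.{u} R G} (hQ : IsFGProjective Q) :
    HomExact Q L.toAugmentedComplex.augmented :=
  (isFGProper_iff _).1 L.proper Q hQ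

end Comparison

/-! ### The resolution attached to a complete resolution -/

/-- A chain map given in high degrees extends to all degrees `≥ 0`. -/
lemma exists_extension {T : ChainComplex (Rep.{u} R G) ℤ} {P : ChainComplex (Rep.{u} R G) ℕ}
    (hTP : ∀ n, CoHomExact T (P.X n)) (N : ℕ) (ψ : ∀ n : ℕ, N ≤ n → (T.X (n : ℤ) ⟶ P.X n))
    (hψ : ∀ (n : ℕ) (hn : N ≤ n), ψ (n + 1) (Nat.le_succ_of_le hn) ≫ P.d (n + 1) n =
      T.d ((n + 1 : ℕ) : ℤ) (n : ℤ) ≫ ψ n hn) :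
    ∃ θ : ∀ n : ℕ, T.X (n : ℤ) ⟶ P.X n,
      (∀ n : ℕ, θ (n + 1) ≫ P.d (n + 1) n = T.d ((n + 1 : ℕ) : ℤ) (n : ℤ) ≫ θ n) ∧
      ∀ (n : ℕ) (hn : N ≤ n), θ n = ψ n hn := by
  -- Induction on the number `k` of degrees below `N` in which commutation has been arranged; the
  -- components further down are placeholders, initially zero.
  have key : ∀ k : ℕ, ∃ θ : ∀ n : ℕ, T.X (n : ℤ) ⟶ P.X n,
      (∀ n : ℕ, N - k ≤ n → θ (n + 1) ≫ P.d (n + 1) n = T.d ((n + 1 : ℕ) : ℤ) (n : ℤ) ≫ θ n) ∧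
      ∀ (n : ℕ) (hn : N ≤ n), θ n = ψ n hn := by
    intro k
    induction k with
    | zero =>
      refine ⟨fun n => if hn : N ≤ n then ψ n hn else 0, fun n hn => ?_, fun n hn => dif_pos hn⟩
      have hn : N ≤ n := hn
      simp only [dif_pos hn, dif_pos (Nat.le_succ_of_le hn)]
      exact hψ n hn
    | succ k ih =>
      obtain ⟨θ, hθ, hθψ⟩ := ih
      by_cases hk : N ≤ k
      · exact ⟨θ, fun n hn => hθ n (by omega), hθψ⟩
      obtain ⟨m, hm⟩ : ∃ m, m + 1 = N - k := ⟨N - k - 1, by omega⟩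
      -- Since θ already commutes one degree higher, `θ (m + 1) ≫ d` is a cocycle, and exactness of
      -- `Hom(T, P_m)` factors it through `T_m`. As `m < N`, replacing `θ m` leaves the prescribed
      -- maps intact.
      obtain ⟨g, hg⟩ := hTP m (k := ((m + 2 : ℕ) : ℤ)) (i := ((m + 1 : ℕ) : ℤ)) (j := (m : ℤ))
        (by simp only [ComplexShape.down_Rel]; omega)
        (by simp only [ComplexShape.down_Rel]; omega) (θ (m + 1) ≫ P.d (m + 1) m) (by
          rw [← Category.assoc, ← hθ (m + 1) (by omega), Category.assoc, P.d_comp_d, comp_zero])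
      refine ⟨Function.update θ m g, fun n hn => ?_, fun n hn => ?_⟩
      · rw [Function.update_of_ne (by omega)]
        by_cases hnm : n = m
        · subst hnm
          rw [Function.update_self, hg]
        · rw [Function.update_of_ne hnm, hθ n (by omega)]
      · rw [Function.update_of_ne (by omega), hθψ n hn]
  obtain ⟨θ, hθ, hθψ⟩ := key N
  exact ⟨θ, fun n => hθ n (by omega), hθψ⟩

/-- The family of maps with alternating signs attached to a chain map. -/
@[simps]
def AntiMap.ofHom {T : ChainComplex (Rep.{u} R G) ℤ} {P : ChainComplex (Rep.{u} R G) ℕ}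
    (θ : ∀ n : ℕ, T.X (n : ℤ) ⟶ P.X n)
    (hθ : ∀ n : ℕ, θ (n + 1) ≫ P.d (n + 1) n = T.d ((n + 1 : ℕ) : ℤ) (n : ℤ) ≫ θ n) :
    AntiMap T P where
  τ n := ((-1 : ℤ) ^ n) • θ n
  comm n := by
    rw [Preadditive.zsmul_comp, hθ, Preadditive.comp_zsmul, pow_succ]
    simp

section ConeResolution

variable {M : Rep.{u} R G} {T : FCompleteResolution M}

/-- The cone of a map from an `𝔉`-strong `𝔉`-complete resolution to its resolution, as an
`𝔉_G`-proper resolution by `𝔉_G`-projectives. -/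
def coneFGResolution (hT : T.IsFStrong) (t : AntiMap T.cx T.res.cx)
    (ht : ∀ n, T.index ≤ n → IsIso (t.τ n)) : FGResolution M :=
  have hX : ∀ Q : Rep.{u} R G, IsFProjective Q → HomExact Q t.coneAugmented.augmented :=
    fun _ hQ => t.homExact_cone T.split.1 (T.split.homExact hQ) (T.res.homExact hQ)
  have hXp : ∀ n, IsFProjective (t.cone.X (n + 1)) := fun n =>
    (T.res.projective (n + 1)).biprod (T.projective (n : ℤ))
  { toAugmentedComplex := t.coneAugmented
    projective := fun n => match n with
      | 0 => ((hT.isTotallyFAcyclic.isFGProjective_cokernel 0).biprod_of_isFProjective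
          (T.res.projective 0)).of_iso (biprod.braiding _ _)
      | n + 1 => (hXp n).isFGProjective
    exact := acyclic_of_homExact (fun j => ⟨j + 1, rfl⟩) hX
    -- Cycle index `n + 2` uses that `τ n` and `τ (n + 1)` are isomorphisms, which holds for `n ≥
    -- T.index`; hence the bound `T.index + 2`.
    proper := isFGProper_of_cyclesExact hX hXp (T.index + 2) (by
      intro S hS j hj
      obtain ⟨n, rfl⟩ : ∃ n, j = n + 2 := ⟨j - 2, by omega⟩
      have := ht n (by omega)
      have := ht (n + 1) (by omega)
      exact t.cyclesExact hS n (T.res.projective (n + 2))) }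

variable (T) in
/-- An `𝔉`-strong `𝔉`-complete resolution maps to its resolution, by the given isomorphisms in
high degrees. -/
lemma exists_map_res (hT : T.IsFStrong) : ∃ θ : ∀ n : ℕ, T.cx.X (n : ℤ) ⟶ T.res.cx.X n,
    (∀ n : ℕ, θ (n + 1) ≫ T.res.cx.d (n + 1) n = T.cx.d ((n + 1 : ℕ) : ℤ) (n : ℤ) ≫ θ n) ∧
    ∀ (n : ℕ) (hn : T.index ≤ n), θ n = (T.iso n hn).hom :=
  exists_extension (fun n => hT.coHomExact (T.res.projective n)) T.index
    (fun n hn => (T.iso n hn).hom) (fun n hn => (T.comm n hn).symm)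

lemma isIso_ofHom_τ {θ : ∀ n : ℕ, T.cx.X (n : ℤ) ⟶ T.res.cx.X n}
    (hθ : ∀ n : ℕ, θ (n + 1) ≫ T.res.cx.d (n + 1) n =
      T.cx.d ((n + 1 : ℕ) : ℤ) (n : ℤ) ≫ θ n)
    (hθi : ∀ (n : ℕ) (hn : T.index ≤ n), θ n = (T.iso n hn).hom) (n : ℕ) (hn : T.index ≤ n) :
    IsIso ((AntiMap.ofHom θ hθ).τ n) := by
  rw [AntiMap.ofHom_τ, hθi n hn]
  rcases neg_one_pow_eq_or ℤ n with h | h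
  · rw [h, one_smul]
    infer_instance
  · rw [h, neg_smul, one_smul]
    exact ⟨-(T.iso n hn).inv, by simp, by simp⟩

theorem nonempty_fgResolution (hT : T.IsFStrong) : Nonempty (FGResolution M) := by
  obtain ⟨θ, hθ, hθi⟩ := exists_map_res T hT
  exact ⟨coneFGResolution hT _ (isIso_ofHom_τ hθ hθi)⟩

end ConeResolution

/-- The long exact sequence relating the three cohomology theories. -/
theorem exists_isLongExact {T : FCompleteResolution (triv R G)} (hT : T.IsFStrong)
    (P : FResolution (triv R G)) (L : FGResolution (triv R G)) :
    ∃ (φ : P.cx ⟶ L.cx) (θ : T.cx ⟶ toInt P.cx) (δ : ∀ n : ℕ, FHhat T n ⟶ FGH L (n + 1)),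
      AugmentedComplex.LiftsId P.toAugmentedComplex L.toAugmentedComplex φ ∧
      IsComparison T P θ ∧
      IsLongExact (fun n => cohomologyMap (toIntMap φ) (n : ℤ))
        (fun n => cohomologyMap θ (n : ℤ)) δ := by
  obtain ⟨ϑ, hϑ, hϑi⟩ := exists_map_res T hT
  let t := AntiMap.ofHom ϑ hϑ
  let K := coneFGResolution hT t (isIso_ofHom_τ hϑ hϑi)
  -- `f` and `g` compare `T.res` with `P`, and `v` and `w` compare `L` with the cone `K`. They
  -- induce mutually inverse maps in positive degrees, along which the sequence of the cone is
  -- transported.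
  obtain ⟨f, hf⟩ := AugmentedComplex.exists_liftsId (C := T.res.toAugmentedComplex)
    (D := P.toAugmentedComplex) fun n => P.homExact (T.res.projective n)
  obtain ⟨g, hg⟩ := AugmentedComplex.exists_liftsId (C := P.toAugmentedComplex)
    (D := T.res.toAugmentedComplex) fun n => T.res.homExact (P.projective n)
  obtain ⟨v, hv⟩ := AugmentedComplex.exists_liftsId (C := L.toAugmentedComplex)
    (D := K.toAugmentedComplex) fun n => K.homExact (L.projective n)
  obtain ⟨w, hw⟩ := AugmentedComplex.exists_liftsId (C := K.toAugmentedComplex)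
    (D := L.toAugmentedComplex) fun n => L.homExact (K.projective n)
  have hι : AugmentedComplex.LiftsId T.res.toAugmentedComplex K.toAugmentedComplex t.coneInl :=
    t.inl_coneε
  have hfg := AugmentedComplex.cohomologyMap_leftInverse
    (fun n => T.res.homExact (T.res.projective n)) hf hg
  have hgf := AugmentedComplex.cohomologyMap_leftInverse
    (fun n => P.homExact (P.projective n)) hg hf
  have hwv := AugmentedComplex.cohomologyMap_leftInverse
    (fun n => K.homExact (K.projective n)) hw hv
  have hvw := AugmentedComplex.cohomologyMap_leftInverse
    (fun n => L.homExact (L.projective n)) hv hw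
  obtain ⟨Θ, hΘ⟩ := exists_hom_toInt T.cx ϑ hϑ
  -- Following θ by `f` gives the comparison map to `P`: in high degrees θ is the given
  -- identification, so `f` itself is the lift of the identity that is required.
  obtain ⟨Θ', hΘ'⟩ := exists_hom_toInt (C := P.cx) T.cx (fun n => ϑ n ≫ f.f n) (fun n => by
    rw [Category.assoc, f.comm, ← Category.assoc, hϑ, Category.assoc])
  have hτ : ∀ n, t.τ n = ((-1 : ℤ) ^ n) • ϑ n := fun _ => rfl
  have hτ' : ∀ n, ϑ n = ((-1 : ℤ) ^ n) • t.τ n := fun n => by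
    rw [hτ, smul_smul, ← mul_pow, neg_one_mul, neg_neg, one_pow, one_smul]
  have hε : ∀ (n : ℕ) (M : Rep.{u} R G) (x : (FGH L (n + 1)).obj M),
      (cohomologyMap (toIntMap (g ≫ t.coneInl ≫ w)) ((n + 1 : ℕ) : ℤ)).app M x =
        (cohomologyMap (toIntMap g) ((n + 1 : ℕ) : ℤ)).app M
          ((cohomologyMap (toIntMap t.coneInl) ((n + 1 : ℕ) : ℤ)).app M
            ((cohomologyMap (toIntMap w) ((n + 1 : ℕ) : ℤ)).app M x)) := fun n M x =>
    (cohomologyMap_comp_apply g (t.coneInl ≫ w) n M x).trans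
      (congrArg _ (cohomologyMap_comp_apply t.coneInl w n M x))
  have hη := cohomologyMap_toIntMap_apply f hΘ hΘ'
  refine ⟨g ≫ t.coneInl ≫ w, Θ',
    fun n => t.coneδ n ≫ cohomologyMap (toIntMap v) ((n + 1 : ℕ) : ℤ),
    hg.comp (hι.comp hw), ⟨f, hf, fun i hi => by rw [hΘ', hϑi i hi]⟩, fun M => ⟨?_, ?_⟩⟩
  · intro x y hxy
    exact (hvw 0 M).injective (t.injective_coneInl_one ((hfg 0 M).injective
      (((hε 0 M x).symm.trans hxy).trans (hε 0 M y))))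
  rintro (_ | n) hn
  · omega
  refine ⟨fun y => ?_, fun y => ?_, fun y => ?_⟩
  · constructor
    · intro hy
      obtain ⟨z, hz⟩ := (t.exact_coneInl_map hΘ hτ' hτ n _).1 ((hη n M y).symm.trans hy)
      refine ⟨(cohomologyMap (toIntMap v) ((n + 1 : ℕ) : ℤ)).app M z, (hε n M _).trans ?_⟩
      refine (congrArg _ ((congrArg _ (hwv n M z)).trans hz)).trans (hgf n M y)
    · rintro ⟨x, rfl⟩
      refine (hη n M _).trans ((t.exact_coneInl_map hΘ hτ' hτ n _).2
        ⟨(cohomologyMap (toIntMap w) ((n + 1 : ℕ) : ℤ)).app M x, ?_⟩)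
      exact ((congrArg _ (hε n M x)).trans (hfg n M _)).symm
  · constructor
    · intro hy
      have hy' : (t.coneδ (n + 1)).app M y = 0 :=
        (hwv (n + 1) M).injective (hy.trans (map_zero _).symm)
      obtain ⟨z, hz⟩ := (t.exact_map_coneδ hΘ hτ' hτ n y).1 hy'
      exact ⟨(cohomologyMap (toIntMap g) ((n + 1 : ℕ) : ℤ)).app M z,
        (hη n M _).trans ((congrArg _ (hfg n M z)).trans hz)⟩
    · rintro ⟨x, rfl⟩
      have : (t.coneδ (n + 1)).app M ((cohomologyMap Θ' ((n + 1 : ℕ) : ℤ)).app M x) = 0 :=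
        (t.exact_map_coneδ hΘ hτ' hτ n _).2 ⟨_, (hη n M x).symm⟩
      exact (congrArg ((cohomologyMap (toIntMap v) ((n + 2 : ℕ) : ℤ)).app M) this).trans
        (map_zero _)
  · constructor
    · intro hy
      have hy' := (hfg (n + 1) M).injective
        (((hε (n + 1) M y).symm.trans hy).trans (map_zero _).symm)
      obtain ⟨z, hz⟩ := (t.exact_coneδ_coneInl n _).1 hy'
      exact ⟨z, (congrArg ((cohomologyMap (toIntMap v) ((n + 2 : ℕ) : ℤ)).app M) hz).trans
        (hvw (n + 1) M y)⟩
    · rintro ⟨x, rfl⟩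
      refine (hε (n + 1) M _).trans ?_
      have h0 := (t.exact_coneδ_coneInl n _).2 ⟨x, rfl⟩
      exact (congrArg ((cohomologyMap (toIntMap g) ((n + 2 : ℕ) : ℤ)).app M)
        ((congrArg _ (hwv (n + 1) M _)).trans h0)).trans (map_zero _)

end FamilyCohomology

end

theorem mainTheorem2 {R G : Type u} [CommRing R] [Group G]
    (T : FamilyCohomology.FCompleteResolution (FamilyCohomology.triv R G)) (hT : T.IsFStrong) :
    Nonempty (FamilyCohomology.FGResolution (FamilyCohomology.triv R G)) ∧
    ∀ (P : FamilyCohomology.FResolution (FamilyCohomology.triv R G))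
      (L : FamilyCohomology.FGResolution (FamilyCohomology.triv R G)),
    ∃ (φ : P.cx ⟶ L.cx) (θ : T.cx ⟶ FamilyCohomology.toInt P.cx)
      (δ : ∀ n : ℕ, FamilyCohomology.FHhat T n ⟶ FamilyCohomology.FGH L (n + 1)),
      FamilyCohomology.AugmentedComplex.LiftsId P.toAugmentedComplex L.toAugmentedComplex φ ∧
      FamilyCohomology.IsComparison T P θ ∧
      FamilyCohomology.IsLongExact
        (fun n => FamilyCohomology.cohomologyMap (FamilyCohomology.toIntMap φ) (n : ℤ))
        (fun n => FamilyCohomology.cohomologyMap θ (n : ℤ)) δ :=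
  ⟨FamilyCohomology.nonempty_fgResolution hT, FamilyCohomology.exists_isLongExact hT⟩
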